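/- Let $\Gamma$ be a discrete abelian group (of arbitrary cardinality), and let $\ell^\infty(\Gamma)$ be the space of bounded functions $f:\Gamma\to\mathbb C$. A *mean* is a linear functional $m:\ell^\infty(\Gamma)\to\mathbb C$ with $m(1_\Gamma)=1$ and $m(f)\ge 0$ whenever $f\ge 0$ pointwise; it is *invariant* if $m(f_\gamma)=m(f)$ for all $f\in\ell^\infty(\Gamma)$ and $\gamma\in\Gamma$, where $f_\gamma(x)=f(x-\gamma)$. An invariant mean is *extreme* if it is an extreme point of the convex set of all invariant means. For $A,B\subseteq\Gamma$ write $m(A):=m(1_A)$, and write $A\subset_m B$ if $m(A\setminus B)=0$. Let $b\Gamma$ be the Bohr compactification of $\Gamma$, that is, the compact Hausdorff abelian group dual to the group $\widehat\Gamma$ of characters $\Gamma\to S^1$ taken with the discrete topology; $\Gamma$ is identified with a dense subgroup of $b\Gamma$ through $\gamma\mapsto(\chi\mapsto\chi(\gamma))$. Let $\mu_{b\Gamma}$ be the Haar probability measure on $b\Gamma$. A set is called $F_\sigma$ if it is a countable union of compact sets. **Theorem.** Let $\nu$ be an extreme invariant mean on $\ell^\infty(\Gamma)$, let $m$ be an invariant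 mean on $\ell^\infty(\Gamma)$, and let $A,B\subseteq\Gamma$. There are $F_\sigma$ sets $\tilde A_\nu,\tilde B_m\subseteq b\Gamma$ such that $\mu_{b\Gamma}(\tilde A_\nu)\ge\nu(A)$, $\mu_{b\Gamma}(\tilde B_m)\ge m(B)$, and $$\nu(A+B)\ \ge\ \mu_{b\Gamma}(\tilde A_\nu+\tilde B_m).$$ Furthermore: 1. if $V\subseteq b\Gamma$ is compact, then $\mu_{b\Gamma}(\tilde A_\nu\cap V)\ge\nu(A\cap V)$ and $\mu_{b\Gamma}(\tilde B_m\cap V)\ge m(B\cap V)$; 2. if $V\subseteq b\Gamma$ is clopen, then $\mu_{b\Gamma}(\tilde A_\nu\cap V)=0\iff\nu(A\cap V)=0$, and $\mu_{b\Gamma}(\tilde B_m\cap V)=0\iff m(B\cap V)=0$; 3. if $V\subseteq\tilde A_\nu+\tilde B_m$ is compact, then $V\cap\Gamma\subset_\nu A+B$. -/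

import Mathlib

open scoped Pointwise ENNReal ComplexOrder

noncomputable section

namespace BohrSumset

/-- The Banach space `ℓ^∞(Γ)` of bounded complex-valued functions on `Γ`, with the supremum norm. -/
abbrev EllInfty (Γ : Type*) : Type _ := lp (fun _ : Γ => ℂ) ∞

/-- The indicator function `1_A`, as an element of `ℓ^∞(Γ)`. -/
def indicatorFn {Γ : Type*} (A : Set Γ) : EllInfty Γ :=
  ⟨A.indicator (fun _ => (1 : ℂ)), by
    refine memℓp_infty ⟨1, ?_⟩
    rintro _ ⟨x, rfl⟩
    by_cases hx : x ∈ A <;> simp [hx]⟩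

/-- The translate `f_γ(x) = f (x - γ)` of a bounded function. -/
def translate {Γ : Type*} [AddCommGroup Γ] (γ : Γ) (f : EllInfty Γ) : EllInfty Γ :=
  ⟨fun x => f (x - γ), by
    refine memℓp_infty ⟨‖f‖, ?_⟩
    rintro _ ⟨x, rfl⟩
    exact lp.norm_apply_le_norm ENNReal.top_ne_zero f (x - γ)⟩

/-- A mean on `ℓ^∞(Γ)`: a complex-linear functional `m` with `m(1_Γ) = 1` and `m(f) ≥ 0` whenever
`f ≥ 0` pointwise.  (In the order of `ℂ` used here, `0 ≤ z` says that `z` is real and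
nonnegative.) -/
structure IsMean {Γ : Type*} (m : EllInfty Γ →ₗ[ℂ] ℂ) : Prop where
  map_one : m (indicatorFn Set.univ) = 1
  nonneg : ∀ f : EllInfty Γ, (∀ x, 0 ≤ f x) → 0 ≤ m f

/-- The set of translation-invariant means on `ℓ^∞(Γ)`. -/
def invariantMeans (Γ : Type*) [AddCommGroup Γ] : Set (EllInfty Γ →ₗ[ℂ] ℂ) :=
  {m | IsMean m ∧ ∀ (γ : Γ) (f : EllInfty Γ), m (translate γ f) = m f}

/-- The set of extreme invariant means: the extreme points of the convex set of invariant means. -/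
def extremeInvariantMeans (Γ : Type*) [AddCommGroup Γ] : Set (EllInfty Γ →ₗ[ℂ] ℂ) :=
  (invariantMeans Γ).extremePoints ℝ

/-- The finitely additive measure `m(A) = m(1_A)` induced by a mean `m` (for a mean, the complex
number `m(1_A)` is real, so taking the real part loses nothing). -/
def meanOf {Γ : Type*} (m : EllInfty Γ →ₗ[ℂ] ℂ) (A : Set Γ) : ℝ := (m (indicatorFn A)).re

/-- `A ⊂_m B`, that is, `m(A \ B) = 0`. -/
def SubsetMod {Γ : Type*} (m : EllInfty Γ →ₗ[ℂ] ℂ) (A B : Set Γ) : Prop := meanOf m (A \ B) = 0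

/-- The group of all characters `Γ → S¹` of the discrete group `Γ`, under pointwise
multiplication. It carries the discrete topology. -/
def DiscreteDual (Γ : Type*) [AddCommGroup Γ] : Type _ := AddChar Γ Circle

instance (Γ : Type*) [AddCommGroup Γ] : CommGroup (DiscreteDual Γ) :=
  inferInstanceAs (CommGroup (AddChar Γ Circle))

instance (Γ : Type*) [AddCommGroup Γ] : TopologicalSpace (DiscreteDual Γ) := ⊥

instance (Γ : Type*) [AddCommGroup Γ] : DiscreteTopology (DiscreteDual Γ) := ⟨rfl⟩

/-- The Bohr compactification `bΓ` of the discrete group `Γ`, constructed as the Pontryagin dual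
of the group of characters of `Γ` with the discrete topology, and written additively. -/
abbrev BohrCompactification (Γ : Type*) [AddCommGroup Γ] : Type _ :=
  Additive (PontryaginDual (DiscreteDual Γ))

/-- The canonical homomorphism `Γ → bΓ`, sending `γ` to the evaluation `χ ↦ χ(γ)`. -/
def bohrEmbedding (Γ : Type*) [AddCommGroup Γ] : Γ →+ BohrCompactification Γ where
  toFun γ := Additive.ofMul
    ({ toFun := fun χ : AddChar Γ Circle => χ γ
       map_one' := AddChar.one_apply γ
       map_mul' := fun χ ψ => AddChar.mul_apply χ ψ γ
       continuous_toFun := continuous_of_discreteTopology } : DiscreteDual Γ →ₜ* Circle)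
  map_zero' := by
    apply Additive.toMul.injective
    exact ContinuousMonoidHom.ext fun χ => AddChar.map_zero_eq_one (χ : AddChar Γ Circle)
  map_add' γ δ := by
    apply Additive.toMul.injective
    exact ContinuousMonoidHom.ext fun χ => AddChar.map_add_eq_mul (χ : AddChar Γ Circle) γ δ

instance (Γ : Type*) [AddCommGroup Γ] : MeasurableSpace (BohrCompactification Γ) := borel _

instance (Γ : Type*) [AddCommGroup Γ] : BorelSpace (BohrCompactification Γ) := ⟨rfl⟩

instance (Γ : Type*) [AddCommGroup Γ] : T2Space (BohrCompactification Γ) :=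
  inferInstanceAs (T2Space (PontryaginDual (DiscreteDual Γ)))

/-- Haar probability measure on the compact group `bΓ`. -/
def bohrHaar (Γ : Type*) [AddCommGroup Γ] :
    MeasureTheory.Measure (BohrCompactification Γ) :=
  MeasureTheory.Measure.addHaarMeasure ⊤

/-- `V ∩ Γ` for `V ⊆ bΓ`, as a subset of `Γ`. -/
def trace {Γ : Type*} [AddCommGroup Γ] (V : Set (BohrCompactification Γ)) : Set Γ :=
  bohrEmbedding Γ ⁻¹' V

end BohrSumset

end

set_option linter.unusedSectionVars false
set_option linter.overlappingInstances false

open scoped ComplexConjugate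

noncomputable section

/-! Put `C = (A + B)ᶜ`. Every invariant mean agrees with the Haar integral on almost periodic
functions, so `L²(bΓ)` sits isometrically in `L²(ν)` and in `L²(m)`. Projecting `1_A`, `1_C` (for
`ν`) and `1_B` (for `m`) to it gives densities `f`, `g`, `h` on `bΓ` with values in `[0, 1]`. No `b
∈ B` moves a point of `A` into `C`, so the average over `b`, with respect to `m`, of `1_B(b) ν(1_A ·
1_C(· + b))` is zero.

The main point (`integral_density_mul_correlation`) is that this average does not change when the
sets are replaced by their densities. It therefore equals `∫ g G`, where `G` is the convolution of
`f` and `h`. The error `w`, which is `1_C` minus its projection, is orthogonal to all characters.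
Extremality makes `ν` ergodic (`correlationMean_eq`), so joint eigenvectors of the shifts on `L²(ν)`
are multiples of characters and `w` is orthogonal to them as well (`inner_eigenvector_eq_zero`). By
a Koopman–von Neumann argument (`matrixCoeffL2_eq_zero`) the correlations of `w` then vanish in
quadratic mean for every invariant mean, so `m` need not be extreme.

Hence `g = 0` almost everywhere on the open set `{G > 0}`, and `ν(A + B) = 1 - ∫ g ≥ μ{G > 0}`.
Since `{f > 0} + {h > 0}` may leave `{G > 0}` at exceptional points, a density argument
(`exists_conull_subsets`) first discards null sets; inner regularity then supplies the `F_σ` sets.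
-/

namespace BohrSumset

/-! ### Means, their Hilbert spaces, and the unitary action of the shifts -/

section Means

variable {Γ : Type*}

theorem indicatorFn_apply (A : Set Γ) (x : Γ) :
    indicatorFn A x = A.indicator (fun _ => (1 : ℂ)) x := rfl

theorem indicatorFn_univ : indicatorFn (Set.univ : Set Γ) = 1 := by
  ext x; simp [indicatorFn_apply]

/-- A bounded function as an element of `ℓ^∞(Γ)`. -/
def ofBounded (f : Γ → ℂ) (C : ℝ) (h : ∀ x, ‖f x‖ ≤ C) : EllInfty Γ :=
  ⟨f, memℓp_infty ⟨C, by rintro _ ⟨x, rfl⟩; exact h x⟩⟩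

@[simp] theorem ofBounded_apply (f : Γ → ℂ) (C : ℝ) (h : ∀ x, ‖f x‖ ≤ C) (x : Γ) :
    ofBounded f C h x = f x := rfl

theorem EllInfty.norm_apply_le (f : EllInfty Γ) (x : Γ) : ‖f x‖ ≤ ‖f‖ :=
  lp.norm_apply_le_norm ENNReal.top_ne_zero f x

@[simp] theorem EllInfty.one_apply (x : Γ) : (1 : EllInfty Γ) x = 1 := rfl

@[simp] theorem EllInfty.mul_apply (f g : EllInfty Γ) (x : Γ) : (f * g) x = f x * g x := rfl

@[simp] theorem EllInfty.smul_apply (c : ℂ) (f : EllInfty Γ) (x : Γ) : (c • f) x = c * f x := rfl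

@[simp] theorem EllInfty.add_apply (f g : EllInfty Γ) (x : Γ) : (f + g) x = f x + g x := rfl

@[simp] theorem EllInfty.sub_apply (f g : EllInfty Γ) (x : Γ) : (f - g) x = f x - g x := rfl

theorem EllInfty.map_star_mul_smul (m : EllInfty Γ →ₗ[ℂ] ℂ) (r : ℂ) (f g : EllInfty Γ) :
    m (star (r • f) * g) = conj r * m (star f * g) := by
  have h : star (r • f) * g = conj r • (star f * g) := by
    ext x
    change conj (r * f x) * g x = conj r * (conj (f x) * g x)
    rw [map_mul, mul_assoc]
  rw [h, map_smul, smul_eq_mul]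

namespace IsMean

variable {m : EllInfty Γ →ₗ[ℂ] ℂ} (hm : IsMean m)
include hm

theorem map_one' : m 1 = 1 := by
  rw [← indicatorFn_univ]; exact hm.map_one

theorem map_mono {f g : EllInfty Γ} (h : ∀ x, f x ≤ g x) : m f ≤ m g := by
  have := hm.nonneg (g - f) fun x => by simpa using h x
  simpa using this

/-- Adding the constant `‖f‖` makes `f` nonnegative and changes `m f` by a real number. -/
theorem im_eq_zero {f : EllInfty Γ} (h : ∀ x, (f x).im = 0) : (m f).im = 0 := by
  have h1 : 0 ≤ m (f + (‖f‖ : ℂ) • 1) := by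
    refine hm.nonneg _ fun x => ?_
    rw [Complex.nonneg_iff]
    have h2 := (Complex.abs_re_le_norm (f x)).trans (f.norm_apply_le x)
    refine ⟨?_, ?_⟩
    · have h3 : ((f + (‖f‖ : ℂ) • 1) x).re = (f x).re + ‖f‖ := by
        rw [EllInfty.add_apply, EllInfty.smul_apply]; simp
      rw [h3]; linarith [neg_abs_le (f x).re]
    · rw [EllInfty.add_apply, EllInfty.smul_apply]; simp [h x]
  rw [Complex.nonneg_iff] at h1
  simpa [hm.map_one'] using h1.2.symm

theorem map_star (f : EllInfty Γ) : m (star f) = conj (m f) := by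
  have h1 : (m (f + star f)).im = 0 := hm.im_eq_zero fun x => by simp
  have h2 : (m (Complex.I • (f - star f))).im = 0 := hm.im_eq_zero fun x => by simp
  simp only [map_add, map_smul, map_sub, smul_eq_mul] at h1 h2
  apply Complex.ext
  · simp at h1 h2 ⊢; linarith
  · simp at h1 h2 ⊢; linarith

end IsMean

/-- `ℓ^∞(Γ)` with the semi-inner product `m(conj f · g)` of a mean `m`. -/
def PreHilbert {m : EllInfty Γ →ₗ[ℂ] ℂ} (_ : IsMean m) : Type _ := EllInfty Γ

section PreHilbert

variable {m : EllInfty Γ →ₗ[ℂ] ℂ} (hm : IsMean m)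
include hm

instance : AddCommGroup (PreHilbert hm) := inferInstanceAs (AddCommGroup (EllInfty Γ))

instance : Module ℂ (PreHilbert hm) := inferInstanceAs (Module ℂ (EllInfty Γ))

/-- The identity map from `ℓ^∞(Γ)` to the pre-Hilbert space of a mean. -/
def toPreHilbert : EllInfty Γ →ₗ[ℂ] PreHilbert hm := LinearMap.id

theorem IsMean.re_map_star_mul_self_nonneg (f : EllInfty Γ) : 0 ≤ (m (star f * f)).re := by
  have := hm.nonneg (star f * f) fun x => star_mul_self_nonneg (f x)
  exact (Complex.nonneg_iff.1 this).1

theorem IsMean.conj_map_star_mul (f g : EllInfty Γ) :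
    conj (m (star g * f)) = m (star f * g) := by
  have h : star (star g * f) = star f * g := by
    ext x
    change conj (conj (g x) * f x) = conj (f x) * g x
    rw [map_mul, Complex.conj_conj, mul_comm]
  rw [← hm.map_star, h]

instance : PreInnerProductSpace.Core ℂ (PreHilbert hm) where
  inner f g := m (star (id f : EllInfty Γ) * (id g : EllInfty Γ))
  conj_inner_symm f g := IsMean.conj_map_star_mul hm f g
  re_inner_nonneg f := IsMean.re_map_star_mul_self_nonneg hm f
  add_left f g h := by
    refine Eq.trans ?_ (map_add m _ _)
    rw [← add_mul, ← star_add]; rfl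
  smul_left f g r := EllInfty.map_star_mul_smul m r f g

instance : SeminormedAddCommGroup (PreHilbert hm) :=
  InnerProductSpace.Core.toSeminormedAddCommGroup (𝕜 := ℂ)

instance : InnerProductSpace ℂ (PreHilbert hm) :=
  InnerProductSpace.ofCore _

theorem inner_toPreHilbert (f g : EllInfty Γ) :
    inner ℂ (toPreHilbert hm f) (toPreHilbert hm g) = m (star f * g) := rfl

/-- The Hilbert space `L²(m)` of a mean `m`. -/
abbrev MeanL2 : Type _ := UniformSpace.Completion (PreHilbert hm)

/-- The canonical map `ℓ^∞(Γ) → L²(m)`. -/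
def toMeanL2 : EllInfty Γ →ₗ[ℂ] MeanL2 hm :=
  (UniformSpace.Completion.toComplL (𝕜 := ℂ) (E := PreHilbert hm)).toLinearMap ∘ₗ toPreHilbert hm

theorem denseRange_toMeanL2 : DenseRange (toMeanL2 hm) :=
  UniformSpace.Completion.denseRange_coe (α := PreHilbert hm)

theorem inner_toMeanL2 (f g : EllInfty Γ) :
    inner ℂ (toMeanL2 hm f) (toMeanL2 hm g) = m (star f * g) :=
  (UniformSpace.Completion.inner_coe _ _).trans (inner_toPreHilbert hm f g)

theorem norm_toMeanL2_le (f : EllInfty Γ) : ‖toMeanL2 hm f‖ ≤ ‖f‖ := by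
  have h1 : m (star f * f) ≤ m ((‖f‖ ^ 2 : ℂ) • 1) := by
    refine hm.map_mono fun x => ?_
    have h2 := f.norm_apply_le x
    have : (star f * f) x = ((‖f x‖ ^ 2 : ℝ) : ℂ) := by
      simp [Complex.conj_mul']
    rw [this]
    have h3 : ((‖f‖ ^ 2 : ℂ) • (1 : EllInfty Γ)) x = ((‖f‖ ^ 2 : ℝ) : ℂ) := by simp
    rw [h3]
    exact Complex.real_le_real.2 (pow_le_pow_left₀ (norm_nonneg _) h2 2)
  rw [← inner_toMeanL2 hm, inner_self_eq_norm_sq_to_K, map_smul, hm.map_one'] at h1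
  have : ‖toMeanL2 hm f‖ ^ 2 ≤ ‖f‖ ^ 2 := by

    simp only [smul_eq_mul, mul_one] at h1
    rw [← Complex.real_le_real]
    push_cast
    exact h1
  exact le_of_sq_le_sq this (norm_nonneg _)

/-- Cauchy–Schwarz in `L²(m)` against the unit vector `1`, as `m f = ⟪1, f⟫`. -/
theorem IsMean.norm_map_le (f : EllInfty Γ) : ‖m f‖ ≤ ‖f‖ := by
  have h := inner_toMeanL2 hm 1 f
  rw [star_one, one_mul] at h
  have h1 : ‖toMeanL2 hm 1‖ = 1 := by
    have := inner_toMeanL2 hm 1 1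
    rw [star_one, one_mul, hm.map_one', inner_self_eq_norm_sq_to_K] at this
    have h2 : ‖toMeanL2 hm 1‖ ^ 2 = 1 := by
      apply Complex.ofReal_injective
      push_cast
      exact this
    exact (pow_eq_one_iff_of_nonneg (norm_nonneg _) two_ne_zero).1 h2
  rw [← h]
  refine (norm_inner_le_norm _ _).trans ?_
  rw [h1, one_mul]
  exact norm_toMeanL2_le hm f

theorem IsMean.map_indicatorFn (A : Set Γ) : m (indicatorFn A) = (meanOf m A : ℂ) := by
  refine Complex.ext rfl (hm.im_eq_zero fun x => ?_)
  by_cases hx : x ∈ A <;> simp [indicatorFn_apply, hx]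

end PreHilbert

section Translation

variable [AddCommGroup Γ]

/-- The shift `f ↦ f (· + b)` on `ℓ^∞(Γ)`. -/
def shift (b : Γ) : EllInfty Γ →ₗ[ℂ] EllInfty Γ where
  toFun := translate (-b)
  map_add' _ _ := rfl
  map_smul' _ _ := rfl

@[simp] theorem shift_apply (b : Γ) (f : EllInfty Γ) (x : Γ) : shift b f x = f (x + b) := by
  change f (x - -b) = _
  rw [sub_neg_eq_add]

theorem shift_mul (b : Γ) (f g : EllInfty Γ) : shift b (f * g) = shift b f * shift b g := rfl

theorem shift_star (b : Γ) (f : EllInfty Γ) : shift b (star f) = star (shift b f) := rfl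

theorem shift_add (a b : Γ) (f : EllInfty Γ) : shift (a + b) f = shift a (shift b f) := by
  ext x; simp [add_assoc]

theorem shift_zero (f : EllInfty Γ) : shift 0 f = f := by
  ext x; simp

variable {m : EllInfty Γ →ₗ[ℂ] ℂ}

theorem map_shift (hm : m ∈ invariantMeans Γ) (b : Γ) (f : EllInfty Γ) : m (shift b f) = m f :=
  hm.2 (-b) f

theorem norm_toMeanL2_shift (hm : m ∈ invariantMeans Γ) (b : Γ) (f : EllInfty Γ) :
    ‖toMeanL2 hm.1 (shift b f)‖ = ‖toMeanL2 hm.1 f‖ := by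
  rw [norm_eq_sqrt_re_inner (𝕜 := ℂ), norm_eq_sqrt_re_inner (𝕜 := ℂ), inner_toMeanL2,
    inner_toMeanL2, ← shift_star, ← shift_mul, map_shift hm]

/-- The unitary operator on `L²(m)` extending the shift by `b`. -/
def koopman (hm : m ∈ invariantMeans Γ) (b : Γ) : MeanL2 hm.1 →L[ℂ] MeanL2 hm.1 :=
  (toMeanL2 hm.1 ∘ₗ shift b).extendOfNorm (toMeanL2 hm.1)

theorem koopman_toMeanL2 (hm : m ∈ invariantMeans Γ) (b : Γ) (f : EllInfty Γ) :
    koopman hm b (toMeanL2 hm.1 f) = toMeanL2 hm.1 (shift b f) :=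
  LinearMap.extendOfNorm_eq (denseRange_toMeanL2 hm.1)
    ⟨1, fun f => by rw [one_mul]; exact (norm_toMeanL2_shift hm b f).le⟩ f

theorem koopman_add (hm : m ∈ invariantMeans Γ) (a b : Γ) (u : MeanL2 hm.1) :
    koopman hm (a + b) u = koopman hm a (koopman hm b u) := by
  induction u using (denseRange_toMeanL2 hm.1).induction_on with
  | hp => exact isClosed_eq (by fun_prop) (by fun_prop)
  | ih f => simp only [koopman_toMeanL2, shift_add]

theorem koopman_zero (hm : m ∈ invariantMeans Γ) (u : MeanL2 hm.1) :
    koopman hm 0 u = u := by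
  induction u using (denseRange_toMeanL2 hm.1).induction_on with
  | hp => exact isClosed_eq (by fun_prop) (by fun_prop)
  | ih f => simp only [koopman_toMeanL2, shift_zero]

theorem inner_koopman_koopman (hm : m ∈ invariantMeans Γ) (b : Γ) (u v : MeanL2 hm.1) :
    inner ℂ (koopman hm b u) (koopman hm b v) = inner ℂ u v := by
  induction u, v using (denseRange_toMeanL2 hm.1).induction_on₂ with
  | hp => exact isClosed_eq (by fun_prop) (by fun_prop)
  | h f g =>
    simp only [koopman_toMeanL2, inner_toMeanL2]
    rw [← shift_star, ← shift_mul, map_shift hm]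

end Translation

end Means

/-! ### Hilbert–Schmidt operators and common eigenvectors -/

section Operators

variable {E F : Type*} [NormedAddCommGroup E] [InnerProductSpace ℂ E]
  [NormedAddCommGroup F] [InnerProductSpace ℂ F]

/-- A Hilbert–Schmidt operator is compact. -/
theorem isCompactOperator_of_sum_norm_sq_le [CompleteSpace F] (R : E →L[ℂ] F) (C : ℝ)
    (h : ∀ (n : ℕ) (e : Fin n → E), Orthonormal ℂ e → ∑ i, ‖R (e i)‖ ^ 2 ≤ C) :
    IsCompactOperator R := by
  let S : Set ℝ := {t | ∃ (n : ℕ) (e : Fin n → E), Orthonormal ℂ e ∧ ∑ i, ‖R (e i)‖ ^ 2 = t}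
  have hS : BddAbove S := ⟨C, by rintro _ ⟨n, e, he, rfl⟩; exact h n e he⟩
  have hne : S.Nonempty := ⟨0, 0, Fin.elim0, ⟨fun i => i.elim0, fun i => i.elim0⟩, by simp⟩
  have key : ∀ ε : ℝ, 0 < ε → ∃ Q : E →L[ℂ] F, IsCompactOperator Q ∧ ‖Q - R‖ ≤ ε := by
    intro ε hε
    -- A finite orthonormal system within `ε²` of the supremum: adjoining one more unit vector `v`
    -- orthogonal to it can add at most `ε²`, so `‖R v‖ ≤ ε`. Thus `R` is within `ε` of its
    -- restriction to a finite-dimensional span, and is a norm limit of compact operators.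
    obtain ⟨_, ⟨n, e, he, rfl⟩, hlt⟩ := exists_lt_of_lt_csSup hne
      (sub_lt_self (sSup S) (pow_pos hε 2))
    let K : Submodule ℂ E := Submodule.span ℂ (Set.range e)
    have hunit : ∀ v ∈ Kᗮ, ‖v‖ = 1 → ‖R v‖ ≤ ε := by
      intro v hv h1
      have ho : Orthonormal ℂ (Matrix.vecCons v e) := by
        rw [orthonormal_vecCons_iff]
        refine ⟨h1, fun i => ?_, he⟩
        exact (Submodule.mem_orthogonal' K v).1 hv _ (Submodule.subset_span ⟨i, rfl⟩)
      have h2 := le_csSup hS ⟨n + 1, _, ho, rfl⟩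
      rw [Fin.sum_univ_succ] at h2
      simp only [Matrix.cons_val_zero, Matrix.cons_val_succ] at h2
      exact le_of_sq_le_sq (by linarith) hε.le
    have horth : ∀ v ∈ Kᗮ, ‖R v‖ ≤ ε * ‖v‖ := by
      intro v hv
      by_cases h0 : v = 0
      · simp [h0]
      have hv0 : 0 < ‖v‖ := norm_pos_iff.2 h0
      have h3 := hunit (((‖v‖⁻¹ : ℝ) : ℂ) • v) (Kᗮ.smul_mem _ hv) (by
        rw [norm_smul]; simp [hv0.ne'])
      rw [map_smul, norm_smul] at h3
      simp only [Complex.norm_real, norm_inv, norm_norm] at h3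
      rwa [inv_mul_le_iff₀ hv0, mul_comm] at h3
    have : FiniteDimensional ℂ K := FiniteDimensional.span_of_finite ℂ (Set.finite_range e)
    refine ⟨R ∘L K.starProjection, ?_, ?_⟩
    · have hid : IsCompactOperator (id : K → K) := by
        rw [isCompactOperator_id_iff_finiteDimensional (𝕜 := ℂ)]; infer_instance
      exact (hid.comp_clm K.orthogonalProjectionOnto).clm_comp (R ∘L K.subtypeL)
    · refine ContinuousLinearMap.opNorm_le_bound _ hε.le fun v => ?_
      have h4 : (R ∘L K.starProjection - R) v = - R (v - K.starProjection v) := by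
        simp
      rw [h4, norm_neg]
      refine (horth _ (Submodule.sub_starProjection_mem_orthogonal v)).trans ?_
      gcongr
      have := Submodule.norm_sq_eq_add_norm_sq_projection v K
      rw [← Submodule.starProjection_orthogonal_val]
      exact Submodule.norm_starProjection_apply_le _ v
  have hcl : IsClosed {Q : E →L[ℂ] F | IsCompactOperator Q} := isClosed_setOfPred_isCompactOperator
  have : R ∈ closure {Q : E →L[ℂ] F | IsCompactOperator Q} := by
    rw [Metric.mem_closure_iff]
    intro ε hε
    obtain ⟨Q, hQ, hQR⟩ := key (ε / 2) (half_pos hε)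
    refine ⟨Q, hQ, ?_⟩
    rw [dist_comm, dist_eq_norm]
    linarith
  rwa [hcl.closure_eq] at this

/-- A commuting family of operators preserving a nonzero finite-dimensional subspace has a common
eigenvector in it. -/
theorem exists_common_eigenvector {ι : Type*} (U : ι → E →L[ℂ] E)
    (hU : ∀ a b v, U a (U b v) = U b (U a v)) (n : ℕ) (W : Submodule ℂ E)
    [FiniteDimensional ℂ W] (hn : Module.finrank ℂ W = n) (hW : W ≠ ⊥)
    (hinv : ∀ a, ∀ v ∈ W, U a v ∈ W) :
    ∃ e ∈ W, e ≠ 0 ∧ ∀ a, ∃ c : ℂ, U a e = c • e := by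
  induction n using Nat.strong_induction_on generalizing W with
  | _ n ih =>
    -- If every operator is scalar on `W`, any nonzero vector will do. Otherwise an eigenspace of a
    -- nonscalar `U a` is a smaller nonzero subspace, invariant by commutativity, and the induction
    -- on dimension applies.
    by_cases hs : ∀ a, ∃ c : ℂ, ∀ v ∈ W, U a v = c • v
    · obtain ⟨e, he, he0⟩ := W.exists_mem_ne_zero_of_ne_bot hW
      exact ⟨e, he, he0, fun a => (hs a).imp fun c hc => hc e he⟩
    push Not at hs
    obtain ⟨a, ha⟩ := hs
    have : Nontrivial W := Submodule.nontrivial_iff_ne_bot.2 hW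
    obtain ⟨c, hc⟩ := Module.End.exists_eigenvalue ((U a).toLinearMap.restrict (hinv a))
    obtain ⟨w, hw⟩ := hc.exists_hasEigenvector
    let W' : Submodule ℂ E := W ⊓ Module.End.eigenspace (U a).toLinearMap c
    have hle : W' ≤ W := inf_le_left
    have hlt : W' < W := by
      refine lt_of_le_of_ne hle fun heq => ?_
      obtain ⟨v, hv, hne⟩ := ha c
      rw [← heq] at hv
      exact hne (Module.End.mem_eigenspace_iff.1 hv.2)
    have hfin : FiniteDimensional ℂ W' := Submodule.finiteDimensional_of_le hle
    have hW' : W' ≠ ⊥ := by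
      refine (Submodule.ne_bot_iff _).2 ⟨w, ⟨w.2, ?_⟩, ?_⟩
      · refine Module.End.mem_eigenspace_iff.2 ?_
        exact congrArg Subtype.val hw.apply_eq_smul
      · simpa using hw.2
    obtain ⟨e, he, h⟩ := ih _ (hn ▸ Submodule.finrank_lt_finrank_of_lt hlt) W' rfl hW'
      fun b v hv => ⟨hinv b v hv.1, Module.End.mem_eigenspace_iff.2 <| by
        have h1 := Module.End.mem_eigenspace_iff.1 hv.2
        change U a (U b v) = c • U b v
        rw [hU, ← map_smul]
        exact congrArg (U b) h1⟩
    exact ⟨e, hle he, h⟩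

end Operators

/-! ### Matrix coefficients of unitary representations that vanish in mean -/

section WeakMixing

variable {Γ H : Type*} [AddCommGroup Γ] [NormedAddCommGroup H] [InnerProductSpace ℂ H]
  [CompleteSpace H] {M : EllInfty Γ →ₗ[ℂ] ℂ} (hM : M ∈ invariantMeans Γ)
  (U : Γ → H →L[ℂ] H) (hUadd : ∀ a b u, U (a + b) u = U a (U b u))
  (hUinner : ∀ a u v, inner ℂ (U a u) (U a v) = inner ℂ u v)

/-- The matrix coefficient `b ↦ ⟪U b w, v⟫` of a unitary representation. -/
def matrixCoeff (hUinner : ∀ a u v, inner ℂ (U a u) (U a v) = inner ℂ u v) (w v : H) :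
    EllInfty Γ :=
  ofBounded (fun b => inner ℂ (U b w) v) (‖w‖ * ‖v‖) fun b => by
    have : ‖U b w‖ = ‖w‖ := by
      rw [norm_eq_sqrt_re_inner (𝕜 := ℂ), hUinner, ← norm_eq_sqrt_re_inner]
    rw [← this]
    exact norm_inner_le_norm _ _

@[simp] theorem matrixCoeff_apply (w v : H) (b : Γ) :
    matrixCoeff U hUinner w v b = inner ℂ (U b w) v := rfl

theorem norm_matrixCoeff_le (w v : H) : ‖matrixCoeff U hUinner w v‖ ≤ ‖w‖ * ‖v‖ :=
  lp.norm_le_of_forall_le (by positivity) fun b => by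
    have : ‖U b w‖ = ‖w‖ := by
      rw [norm_eq_sqrt_re_inner (𝕜 := ℂ), hUinner, ← norm_eq_sqrt_re_inner]
    rw [← this]
    exact norm_inner_le_norm _ _

/-- The operator sending `v` to the matrix coefficient `b ↦ ⟪U b w, v⟫` in `L²(M)`. -/
def matrixCoeffL2 (w : H) : H →L[ℂ] MeanL2 hM.1 :=
  (toMeanL2 hM.1 ∘ₗ
    { toFun := matrixCoeff U hUinner w
      map_add' := fun u v => by ext b; simp
      map_smul' := fun c v => by ext b; simp } : H →ₗ[ℂ] _).mkContinuous ‖w‖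
    fun v => (norm_toMeanL2_le _ _).trans (norm_matrixCoeff_le U hUinner w v)

theorem matrixCoeffL2_apply (w v : H) :
    matrixCoeffL2 hM U hUinner w v = toMeanL2 hM.1 (matrixCoeff U hUinner w v) := rfl

theorem norm_sq_matrixCoeffL2 (w v : H) :
    ((‖matrixCoeffL2 hM U hUinner w v‖ ^ 2 : ℝ) : ℂ) =
      M (star (matrixCoeff U hUinner w v) * matrixCoeff U hUinner w v) := by
  rw [← inner_toMeanL2 hM.1, inner_self_eq_norm_sq_to_K, matrixCoeffL2_apply]
  norm_cast

-- Hilbert–Schmidt bound: for orthonormal `e i`, Bessel's inequality gives `∑ i, |⟪U b w, e i⟫|² ≤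
-- ‖U b w‖² = ‖w‖²` for each `b`, and the mean `M` preserves this bound.
include hM in
theorem isCompactOperator_matrixCoeffL2 (w : H) :
    IsCompactOperator (matrixCoeffL2 hM U hUinner w) := by
  refine isCompactOperator_of_sum_norm_sq_le _ (‖w‖ ^ 2) fun n e he => ?_
  rw [← Complex.real_le_real, Complex.ofReal_sum]
  simp_rw [norm_sq_matrixCoeffL2]
  rw [← map_sum]
  have h1 : ((‖w‖ ^ 2 : ℝ) : ℂ) = M (((‖w‖ ^ 2 : ℝ) : ℂ) • 1) := by
    rw [map_smul, hM.1.map_one', smul_eq_mul, mul_one]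
  rw [h1]
  refine hM.1.map_mono fun b => ?_
  have h2 : (∑ i, star (matrixCoeff U hUinner w (e i)) * matrixCoeff U hUinner w (e i) :
      EllInfty Γ) b = ((∑ i, ‖inner ℂ (e i) (U b w)‖ ^ 2 : ℝ) : ℂ) := by
    rw [lp.coeFn_sum, Finset.sum_apply, Complex.ofReal_sum]
    refine Finset.sum_congr rfl fun i _ => ?_
    rw [norm_inner_symm]
    push_cast
    exact Complex.conj_mul' _
  have h3 : (((‖w‖ ^ 2 : ℝ) : ℂ) • (1 : EllInfty Γ)) b = ((‖w‖ ^ 2 : ℝ) : ℂ) := by simp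
  rw [h2, h3, Complex.real_le_real]
  have h4 : ‖U b w‖ = ‖w‖ := by
    rw [norm_eq_sqrt_re_inner (𝕜 := ℂ), hUinner, ← norm_eq_sqrt_re_inner]
  rw [← h4]
  exact he.sum_inner_products_le _

-- `⟪U b w, U a v⟫ = ⟪U (b - a) w, v⟫`. This intertwining makes `R† R` commute with the
-- representation.
include hUadd in
theorem matrixCoeffL2_map (w v : H) (a : Γ) :
    matrixCoeffL2 hM U hUinner w (U a v) = koopman hM (-a) (matrixCoeffL2 hM U hUinner w v) := by
  rw [matrixCoeffL2_apply, matrixCoeffL2_apply, koopman_toMeanL2]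
  congr 1
  ext b
  rw [shift_apply, matrixCoeff_apply, matrixCoeff_apply, ← hUinner a (U (b + -a) w) v, ← hUadd,
    add_comm b, add_neg_cancel_left]

include hUadd in
/-- A vector orthogonal to all joint eigenvectors of a unitary representation of an abelian group
has matrix coefficients which vanish in quadratic mean. -/
theorem matrixCoeffL2_eq_zero (w : H)
    (hw : ∀ e : H, (∀ b, ∃ c : ℂ, U b e = c • e) → inner ℂ w e = 0) :
    matrixCoeffL2 hM U hUinner w = 0 := by
  set R := matrixCoeffL2 hM U hUinner w with hR
  -- `T` is compact, self-adjoint and commutes with all `U a`. A nonzero eigenvalue would have a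
  -- finite-dimensional invariant eigenspace, hence a joint eigenvector `e`; but then `⟪U b w, e⟫`
  -- is a multiple of `⟪w, e⟫ = 0`, so `R e = 0`. Thus `T = 0` by the spectral theorem.
  let T : H →L[ℂ] H := R.adjoint ∘L R
  have hTinner : ∀ u v, inner ℂ (T u) v = inner ℂ (R u) (R v) := fun u v =>
    ContinuousLinearMap.adjoint_inner_left R v (R u)
  have hTc : IsCompactOperator T :=
    (isCompactOperator_matrixCoeffL2 hM U hUinner w).clm_comp R.adjoint
  have hTs : T.IsSymmetric := (ContinuousLinearMap.isPositive_adjoint_comp_self R).isSymmetric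
  have hU0 : ∀ u, U 0 u = u := fun u => by
    refine ext_inner_left ℂ fun v => ?_
    rw [← hUinner 0 v, ← hUadd, add_zero, hUinner]
  have hUneg : ∀ a u, U a (U (-a) u) = u := fun a u => by
    rw [← hUadd, add_neg_cancel, hU0]
  have hTU : ∀ a u, T (U a u) = U a (T u) := fun a u => by
    refine ext_inner_right ℂ fun v => ?_
    rw [← hUneg a v, hUinner, hTinner, hTinner, hR, matrixCoeffL2_map hM U hUadd,
      matrixCoeffL2_map hM U hUadd, inner_koopman_koopman]
  have hT : T = 0 := by
    rw [← ContinuousLinearMap.eq_zero_of_forall_hasEigenvalue_eq_zero hTc hTs]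
    intro μ hμ
    by_contra hμ0
    have := ContinuousLinearMap.finite_dimensional_eigenspace hTc μ hμ0
    obtain ⟨e, he, he0, hce⟩ := exists_common_eigenvector U
      (fun a b v => by rw [← hUadd, ← hUadd, add_comm]) _
      (Module.End.eigenspace T.toLinearMap μ) rfl hμ fun a v hv => by
        rw [Module.End.mem_eigenspace_iff] at hv ⊢
        change T v = μ • v at hv
        change T (U a v) = μ • U a v
        rw [hTU, hv, map_smul]
    have h0 : R e = 0 := by
      rw [hR, matrixCoeffL2_apply]
      have : matrixCoeff U hUinner w e = 0 := by
        ext b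
        obtain ⟨c, hc⟩ := hce (-b)
        rw [matrixCoeff_apply, ← hUinner (-b), ← hUadd, neg_add_cancel, hU0, hc, inner_smul_right,
          hw e hce, mul_zero]
        rfl
      rw [this, map_zero]
    have h1 : T e = μ • e := Module.End.mem_eigenspace_iff.1 he
    have h2 : T e = 0 := by change R.adjoint (R e) = 0; rw [h0, map_zero]
    rw [h2] at h1
    exact (smul_ne_zero hμ0 he0) h1.symm
  ext v
  have := hTinner v v
  rw [hT] at this
  simpa using this.symm

end WeakMixing

/-! ### Ergodicity of extreme invariant means, and eigenvectors of the shifts -/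

section Ergodic

variable {Γ : Type*} [AddCommGroup Γ] {ν m : EllInfty Γ →ₗ[ℂ] ℂ}

theorem norm_shift_le (b : Γ) (f : EllInfty Γ) : ‖shift b f‖ ≤ ‖f‖ :=
  lp.norm_le_of_forall_le (norm_nonneg _) fun x => by
    rw [shift_apply]; exact f.norm_apply_le _

/-- The correlation `b ↦ ν(g · f(· + b))`. -/
def correlation (hν : IsMean ν) (f g : EllInfty Γ) : EllInfty Γ :=
  ofBounded (fun b => ν (g * shift b f)) (‖g‖ * ‖f‖) fun b =>
    (hν.norm_map_le _).trans <| (norm_mul_le _ _).trans <| by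
      gcongr; exact norm_shift_le b f

@[simp] theorem correlation_apply (hν : IsMean ν) (f g : EllInfty Γ) (b : Γ) :
    correlation hν f g b = ν (g * shift b f) := rfl

/-- For a fixed `f`, the functional `g ↦ m_b ν(g · f(· + b))`. -/
def correlationMean (hν : IsMean ν) (m : EllInfty Γ →ₗ[ℂ] ℂ) (f : EllInfty Γ) :
    EllInfty Γ →ₗ[ℂ] ℂ :=
  m ∘ₗ
    { toFun := correlation hν f
      map_add' := fun g h => by
        ext b
        rw [correlation_apply, add_mul, map_add]; rfl
      map_smul' := fun c g => by
        ext b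
        rw [correlation_apply, smul_mul_assoc, map_smul]; rfl }

theorem correlationMean_apply (hν : IsMean ν) (f g : EllInfty Γ) :
    correlationMean hν m f g = m (correlation hν f g) := rfl

/-- Shifting both factors inside `ν` turns a shift of `g` into a translation of the averaging
variable `b`, which `m` does not see. -/
theorem correlationMean_shift (hν : ν ∈ invariantMeans Γ) (hm : m ∈ invariantMeans Γ)
    (f g : EllInfty Γ) (a : Γ) :
    correlationMean hν.1 m f (shift a g) = correlationMean hν.1 m f g := by
  rw [correlationMean_apply, correlationMean_apply, ← map_shift hm (-a) (correlation _ f g)]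
  congr 1
  ext b
  rw [shift_apply, correlation_apply, correlation_apply, ← map_shift hν a (g * _), shift_mul,
    ← shift_add]
  congr 4
  abel

theorem correlation_nonneg (hν : IsMean ν) {f g : EllInfty Γ} (hf : ∀ x, 0 ≤ f x)
    (hg : ∀ x, 0 ≤ g x) (b : Γ) : 0 ≤ correlation hν f g b :=
  hν.nonneg _ fun x => by
    rw [EllInfty.mul_apply, shift_apply]
    exact mul_nonneg (hg x) (hf _)

theorem IsMean.map_const (hm : IsMean m) (c : ℂ) {f : EllInfty Γ} (hf : ∀ x, f x = c) :
    m f = c := by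
  have : f = c • 1 := by ext x; simp [hf x]
  rw [this, map_smul, hm.map_one', smul_eq_mul, mul_one]

theorem invariant_of_shift (h : ∀ (a : Γ) (f : EllInfty Γ), m (shift a f) = m f) (γ : Γ)
    (f : EllInfty Γ) : m (translate γ f) = m f := by
  rw [← h (-γ) f]
  change _ = m (translate (- -γ) f)
  rw [neg_neg]

/-- For `0 ≤ f ≤ 1` the functional `l` is invariant, has mass `ν f` and satisfies `0 ≤ l ≤ ν` on
nonnegative functions. So `ν ± (l - ν f • ν)` are invariant means with midpoint `ν`, and extremality
forces the perturbation to vanish. -/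
theorem correlationMean_eq_of_mem_Icc (hν : ν ∈ extremeInvariantMeans Γ)
    (hm : m ∈ invariantMeans Γ) {f : EllInfty Γ} (h0 : ∀ x, 0 ≤ f x) (h1 : ∀ x, f x ≤ 1) :
    correlationMean hν.1.1 m f = ν f • ν := by
  have hν' := hν.1.1
  set l := correlationMean hν.1.1 m f with hl
  have hl1 : l 1 = ν f := by
    rw [hl, correlationMean_apply]
    refine hm.1.map_const _ fun b => ?_
    rw [correlation_apply, one_mul, map_shift hν.1]
  have hl0 : ∀ g : EllInfty Γ, (∀ x, 0 ≤ g x) → 0 ≤ l g := fun g hg =>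
    hm.1.nonneg _ fun b => correlation_nonneg hν' h0 hg b
  have hlν : ∀ g : EllInfty Γ, (∀ x, 0 ≤ g x) → l g ≤ ν g := fun g hg => by
    rw [← hm.1.map_const (ν g) (f := ν g • 1) fun x => by simp]
    refine hm.1.map_mono fun b => ?_
    have h2 : (ν g • (1 : EllInfty Γ)) b = ν g := by simp
    rw [h2]
    change ν (g * shift b f) ≤ ν g
    refine hν'.map_mono fun x => ?_
    rw [EllInfty.mul_apply, shift_apply]
    exact mul_le_of_le_one_right (hg x) (h1 _)
  have hc0 : 0 ≤ ν f := hν'.nonneg f h0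
  have hc1 : ν f ≤ 1 := by
    rw [← hν'.map_one']; exact hν'.map_mono h1
  have mem : ∀ p q : EllInfty Γ →ₗ[ℂ] ℂ, p = ν + l - ν f • ν → q = ν - l + ν f • ν →
      p ∈ invariantMeans Γ ∧ q ∈ invariantMeans Γ := by
    rintro p q rfl rfl
    refine ⟨⟨⟨?_, fun g hg => ?_⟩, invariant_of_shift fun a g => ?_⟩,
      ⟨⟨?_, fun g hg => ?_⟩, invariant_of_shift fun a g => ?_⟩⟩
    · rw [indicatorFn_univ]; simp [hl1, hν'.map_one']
    · have h3 : (ν + l - ν f • ν) g = (1 - ν f) * ν g + l g := by simp; ring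
      rw [h3]
      exact add_nonneg (mul_nonneg (sub_nonneg.2 hc1) (hν'.nonneg g hg)) (hl0 g hg)
    · simp [map_shift hν.1, hl, correlationMean_shift hν.1 hm]
    · rw [indicatorFn_univ]; simp [hl1, hν'.map_one']
    · have h3 : (ν - l + ν f • ν) g = (ν g - l g) + ν f * ν g := by simp
      rw [h3]
      exact add_nonneg (sub_nonneg.2 (hlν g hg)) (mul_nonneg hc0 (hν'.nonneg g hg))
    · simp [map_shift hν.1, hl, correlationMean_shift hν.1 hm]
  obtain ⟨hp, hq⟩ := mem _ _ rfl rfl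
  have h4 : ν ∈ openSegment ℝ (ν + l - ν f • ν) (ν - l + ν f • ν) := by
    refine ⟨1 / 2, 1 / 2, by norm_num, by norm_num, by norm_num, ?_⟩
    rw [← smul_add]
    have : (ν + l - ν f • ν) + (ν - l + ν f • ν) = (2 : ℝ) • ν := by
      rw [two_smul]; abel
    rw [this, smul_smul]; norm_num
  have h5 := hν.2 hp hq h4
  have h6 : l - ν f • ν = 0 := by
    have := congrArg (fun z => z - ν) h5
    simpa [add_sub_assoc] using this
  exact sub_eq_zero.1 h6

theorem correlationMean_add (hν : IsMean ν) (f₁ f₂ : EllInfty Γ) :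
    correlationMean hν m (f₁ + f₂) = correlationMean hν m f₁ + correlationMean hν m f₂ := by
  ext g
  rw [LinearMap.add_apply, correlationMean_apply, correlationMean_apply, correlationMean_apply,
    ← map_add]
  congr 1
  ext b
  rw [EllInfty.add_apply]
  simp only [correlation_apply]
  rw [map_add, mul_add, map_add]

theorem correlationMean_smul (hν : IsMean ν) (c : ℂ) (f : EllInfty Γ) :
    correlationMean hν m (c • f) = c • correlationMean hν m f := by
  ext g
  rw [LinearMap.smul_apply, correlationMean_apply, correlationMean_apply, ← map_smul]
  congr 1
  ext b
  rw [EllInfty.smul_apply, correlation_apply, correlation_apply, map_smul, mul_smul_comm, map_smul,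
    smul_eq_mul]

/-- Extreme invariant means are ergodic: `m_b ν(g · f(· + b)) = ν(f) ν(g)` for each invariant
mean `m`. -/
theorem correlationMean_eq (hν : ν ∈ extremeInvariantMeans Γ) (hm : m ∈ invariantMeans Γ)
    (f : EllInfty Γ) : correlationMean hν.1.1 m f = ν f • ν := by
  let S : Submodule ℂ (EllInfty Γ) :=
    { carrier := {f | correlationMean hν.1.1 m f = ν f • ν}
      add_mem' := fun {a b} ha hb => by
        change correlationMean hν.1.1 m _ = _
        rw [correlationMean_add, ha, hb, map_add, add_smul]
      zero_mem' := by
        have := correlationMean_smul (m := m) hν.1.1 0 0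
        change correlationMean hν.1.1 m _ = _
        simpa using this
      smul_mem' := fun c a ha => by
        change correlationMean hν.1.1 m _ = _
        rw [correlationMean_smul, ha, map_smul, smul_assoc] }
  have hunit : ∀ f : EllInfty Γ, (∀ x, 0 ≤ f x) → (∀ x, f x ≤ 1) → f ∈ S := fun f h0 h1 =>
    correlationMean_eq_of_mem_Icc hν hm h0 h1
  have hone : (1 : EllInfty Γ) ∈ S := hunit 1 (fun x => by simp) fun x => by simp
  have hreal : ∀ f : EllInfty Γ, (∀ x, (f x).im = 0) → f ∈ S := by
    intro f hf
    let N : ℝ := ‖f‖ + 1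
    have hN : 0 < N := by positivity
    -- Affine rescaling of the real function `f` into `[0, 1]`; the `+ 1` in `N` keeps it positive
    -- when `f = 0`.
    let g : EllInfty Γ := (((2 * N)⁻¹ : ℝ) : ℂ) • (f + (N : ℂ) • 1)
    have hg : ∀ x, g x = (((2 * N)⁻¹ * ((f x).re + N) : ℝ) : ℂ) := fun x => by
      change (((2 * N)⁻¹ : ℝ) : ℂ) * (f x + (N : ℂ) * 1) = _
      rw [← Complex.re_add_im (f x), hf x]
      push_cast
      simp
    have hb : ∀ x, |(f x).re| ≤ N := fun x =>
      ((Complex.abs_re_le_norm _).trans (f.norm_apply_le x)).trans (by simp [N])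
    have hgS : g ∈ S := by
      refine hunit g (fun x => ?_) fun x => ?_
      · rw [hg x, ← Complex.ofReal_zero, Complex.real_le_real]
        have := (abs_le.1 (hb x)).1
        exact mul_nonneg (by positivity) (by linarith)
      · rw [hg x, ← Complex.ofReal_one, Complex.real_le_real, inv_mul_le_iff₀ (by positivity)]
        have := (abs_le.1 (hb x)).2
        linarith
    have : f = ((2 * N : ℝ) : ℂ) • g - (N : ℂ) • 1 := by
      have h2N : ((2 * N : ℝ) : ℂ) * (((2 * N)⁻¹ : ℝ) : ℂ) = 1 := by
        rw [← Complex.ofReal_mul, mul_inv_cancel₀ (by positivity), Complex.ofReal_one]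
      rw [smul_smul, h2N, one_smul, add_sub_cancel_right]
    rw [this]
    exact S.sub_mem (S.smul_mem _ hgS) (S.smul_mem _ hone)
  have h1 : f = (1 / 2 : ℂ) • (f + star f) + (- Complex.I / 2) • (Complex.I • (f - star f)) := by
    ext x
    change f x = (1 / 2 : ℂ) * (f x + conj (f x)) +
      (- Complex.I / 2) * (Complex.I * (f x - conj (f x)))
    linear_combination (1 / 2 * (f x - conj (f x))) * Complex.I_mul_I
  have : f ∈ S := by
    rw [h1]
    refine S.add_mem (S.smul_mem _ (hreal _ fun x => ?_)) (S.smul_mem _ (hreal _ fun x => ?_))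
    · change (f x + conj (f x)).im = 0
      simp
    · change (Complex.I * (f x - conj (f x))).im = 0
      simp
  exact this

/-- A character as a bounded function. -/
def charFn (χ : AddChar Γ Circle) : EllInfty Γ :=
  ofBounded (fun x => (χ x : ℂ)) 1 fun x => (Circle.norm_coe (χ x)).le

@[simp] theorem charFn_apply (χ : AddChar Γ Circle) (x : Γ) : charFn χ x = (χ x : ℂ) := rfl

theorem Circle.conj_mul_self (z : Circle) : conj (z : ℂ) * z = 1 := by
  rw [Complex.conj_mul', Circle.norm_coe]; simp

/-- If `w ∈ L²(ν)` is orthogonal to all characters, it is orthogonal to all joint eigenvectors of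
the shifts. -/
theorem inner_eigenvector_eq_zero (hν : ν ∈ extremeInvariantMeans Γ) (w : MeanL2 hν.1.1)
    (hw : ∀ χ : AddChar Γ Circle, inner ℂ w (toMeanL2 hν.1.1 (charFn χ)) = 0)
    (e : MeanL2 hν.1.1) (he : ∀ b, ∃ c : ℂ, koopman hν.1 b e = c • e) : inner ℂ w e = 0 := by
  by_cases he0 : e = 0
  · rw [he0, inner_zero_right]
  choose c hc using he
  have hnorm : ∀ b (u : MeanL2 hν.1.1), ‖koopman hν.1 b u‖ = ‖u‖ := fun b u => by
    rw [norm_eq_sqrt_re_inner (𝕜 := ℂ), inner_koopman_koopman, ← norm_eq_sqrt_re_inner]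
  have hc1 : ∀ b, ‖c b‖ = 1 := fun b => by
    have := hnorm b e
    rw [hc, norm_smul] at this
    exact mul_right_cancel₀ (norm_ne_zero_iff.2 he0) (this.trans (one_mul _).symm)
  have hinj : ∀ {x y : ℂ}, x • e = y • e → x = y := fun h => smul_left_injective ℂ he0 h
  -- The eigenvalues have modulus one because the shifts are isometric, and are multiplicative
  -- because the shifts form a representation.
  let χ : AddChar Γ Circle :=
    { toFun := fun b => ⟨c b, mem_sphere_zero_iff_norm.2 (hc1 b)⟩
      map_zero_eq_one' := by
        apply Circle.ext
        apply hinj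
        change c 0 • e = (1 : ℂ) • e
        rw [← hc, koopman_zero, one_smul]
      map_add_eq_mul' := fun a b => by
        apply Circle.ext
        apply hinj
        change c (a + b) • e = (c a * c b) • e
        rw [← hc, koopman_add, hc b, map_smul, hc a, smul_smul, mul_comm] }
  have hχ : ∀ b, koopman hν.1 b e = (χ b : ℂ) • e := hc
  have key : ∀ ε : ℝ, 0 < ε → ‖inner ℂ w e‖ ≤ ‖w‖ * ε := by
    intro ε hε
    obtain ⟨f, hf⟩ := (denseRange_toMeanL2 hν.1.1).exists_dist_lt e hε
    rw [dist_eq_norm] at hf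
    -- Heuristically `conj χ · e` is shift-invariant, so by ergodicity it is a constant, and `e` is
    -- a multiple of `χ`. As `e` need not be a bounded function, this is run on the approximation
    -- `f`, with `ν f'` as the approximate constant.
    let f' : EllInfty Γ := star (charFn χ) * f
    have h1 : ∀ g : EllInfty Γ,
        ‖inner ℂ (toMeanL2 hν.1.1 g) (e - ν f' • toMeanL2 hν.1.1 (charFn χ))‖ ≤
          ‖toMeanL2 hν.1.1 g‖ * ε := by
      intro g
      have h2 := congrArg (fun l => l (star g * charFn χ)) (correlationMean_eq hν hν.1 f')
      simp only [LinearMap.smul_apply, smul_eq_mul] at h2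
      rw [correlationMean_apply, ← inner_toMeanL2 hν.1.1 g] at h2
      rw [inner_sub_right, inner_smul_right, ← h2,
        ← hν.1.1.map_const (inner ℂ (toMeanL2 hν.1.1 g) e)
          (f := inner ℂ (toMeanL2 hν.1.1 g) e • 1) (fun x => by simp), ← map_sub]
      refine (hν.1.1.norm_map_le _).trans ?_
      refine lp.norm_le_of_forall_le (by positivity) fun b => ?_
      -- After multiplication by the unimodular `χ b`, the correlation becomes `⟪g, U_b f⟫` and the
      -- constant `⟪g, e⟫` becomes `⟪g, U_b e⟫`. They differ by at most `‖g‖ ‖e - f‖`, uniformly in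
      -- `b`, so averaging keeps the bound.
      have h3 : (χ b : ℂ) * correlation hν.1.1 f' (star g * charFn χ) b =
          inner ℂ (toMeanL2 hν.1.1 g) (koopman hν.1 b (toMeanL2 hν.1.1 f)) := by
        rw [koopman_toMeanL2, inner_toMeanL2, correlation_apply, ← smul_eq_mul, ← map_smul]
        congr 1
        ext x
        change (χ b : ℂ) * ((conj (g x) * χ x) * shift b f' x) = conj (g x) * shift b f x
        rw [shift_apply, shift_apply]
        change (χ b : ℂ) * ((conj (g x) * χ x) * (conj (χ (x + b) : ℂ) * f (x + b))) = _
        have h4 := Circle.conj_mul_self (χ (x + b))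
        rw [AddChar.map_add_eq_mul, Circle.coe_mul] at h4 ⊢
        linear_combination (conj (g x) * f (x + b)) * h4
      have h5 : (χ b : ℂ) * inner ℂ (toMeanL2 hν.1.1 g) e =
          inner ℂ (toMeanL2 hν.1.1 g) (koopman hν.1 b e) := by
        rw [hχ, inner_smul_right]
      have h6 : (inner ℂ (toMeanL2 hν.1.1 g) e • (1 : EllInfty Γ) -
          correlation hν.1.1 f' (star g * charFn χ)) b = inner ℂ (toMeanL2 hν.1.1 g) e -
          correlation hν.1.1 f' (star g * charFn χ) b := by
        rw [EllInfty.sub_apply, EllInfty.smul_apply]; simp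
      rw [h6, ← one_mul ‖_ - _‖, ← Circle.norm_coe (χ b), ← norm_mul, mul_sub, h3, h5,
        ← inner_sub_right, ← map_sub]
      refine (norm_inner_le_norm _ _).trans ?_
      rw [hnorm]
      gcongr
    have h7 : ∀ u : MeanL2 hν.1.1,
        ‖inner ℂ u (e - ν f' • toMeanL2 hν.1.1 (charFn χ))‖ ≤ ‖u‖ * ε := fun u => by
      induction u using (denseRange_toMeanL2 hν.1.1).induction_on with
      | hp => exact isClosed_le (by fun_prop) (by fun_prop)
      | ih g => exact h1 g
    have h8 := h7 w
    rwa [inner_sub_right, inner_smul_right, hw, mul_zero, sub_zero] at h8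
  have h9 : ‖inner ℂ w e‖ ≤ 0 := by
    refine le_of_forall_pos_le_add fun δ hδ => ?_
    refine (key (δ / (‖w‖ + 1)) (by positivity)).trans ?_
    rw [zero_add, mul_div_assoc', div_le_iff₀ (by positivity)]
    nlinarith [norm_nonneg w]
  exact norm_le_zero_iff.1 h9

end Ergodic

/-! ### Correlations and density points on compact groups -/

section CompactGroup

open MeasureTheory Filter Topology

variable {K : Type*} [AddCommGroup K] [TopologicalSpace K] [IsTopologicalAddGroup K]
  [CompactSpace K] [T2Space K] [MeasurableSpace K] [BorelSpace K]
  (μ : Measure K) [μ.IsAddHaarMeasure] [μ.Regular] [IsProbabilityMeasure μ]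

/-- Translation `p ↦ p(· + y)` as an isometry of `L²`. -/
def translateL2 (𝕜 : Type*) [RCLike 𝕜] (y : K) : Lp 𝕜 2 μ →ₗᵢ[𝕜] Lp 𝕜 2 μ :=
  Lp.compMeasurePreservingₗᵢ 𝕜 (fun x => x + y) (measurePreserving_add_right μ y)

theorem coeFn_translateL2 {𝕜 : Type*} [RCLike 𝕜] (y : K) (p : Lp 𝕜 2 μ) :
    translateL2 μ 𝕜 y p =ᵐ[μ] fun x => p (x + y) :=
  Lp.coeFn_compMeasurePreserving p (measurePreserving_add_right μ y)

theorem continuous_translateL2 {𝕜 : Type*} [RCLike 𝕜] (p : Lp 𝕜 2 μ) :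
    Continuous fun y => translateL2 μ 𝕜 y p := by
  have hg : Continuous (fun y : K => (⟨fun x => x + y, by fun_prop⟩ : C(K, K))) :=
    (ContinuousMap.mk (fun a : K × K => a.2 + a.1) (by fun_prop)).curry.continuous
  exact Continuous.compMeasurePreservingLp (p := 2) (continuous_const (y := p)) hg
    (fun y => measurePreserving_add_right μ y) (by norm_num)

/-- Reflection `p ↦ p(-·)` as an isometry of real `L²`. -/
def reflectL2 : Lp ℝ 2 μ →ₗᵢ[ℝ] Lp ℝ 2 μ :=
  Lp.compMeasurePreservingₗᵢ ℝ (fun x => -x) (Measure.measurePreserving_neg μ)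

/-- The correlation `y ↦ ∫ p(x + y) q(x) dx` of two `L²` functions, as a continuous function. -/
def corr : Lp ℝ 2 μ →L[ℝ] Lp ℝ 2 μ →L[ℝ] C(K, ℝ) :=
  LinearMap.mkContinuous₂
    (LinearMap.mk₂ ℝ
      (fun p q => (⟨fun y => inner ℝ (translateL2 μ ℝ y p) q,
        (continuous_translateL2 μ p).inner continuous_const⟩ : C(K, ℝ)))
      (fun p p' q => by ext y; simp [inner_add_left])
      (fun c p q => by ext y; simp [inner_smul_left])
      (fun p q q' => by ext y; simp [inner_add_right])
      (fun c p q => by ext y; simp [inner_smul_right])) 1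
    (fun p q => by
      rw [one_mul, ContinuousMap.norm_le _ (by positivity)]
      intro y
      refine (norm_inner_le_norm (𝕜 := ℝ) (translateL2 μ ℝ y p) q).trans ?_
      rw [LinearIsometry.norm_map])

theorem corr_apply (p q : Lp ℝ 2 μ) (y : K) : corr μ p q y = inner ℝ (translateL2 μ ℝ y p) q := rfl

theorem corr_toLp {f g : K → ℝ} (hf : MemLp f 2 μ) (hg : MemLp g 2 μ) (y : K) :
    corr μ (hf.toLp f) (hg.toLp g) y = ∫ x, f (x + y) * g x ∂μ := by
  rw [corr_apply, L2.inner_def]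
  refine integral_congr_ae ?_
  have h1 := (measurePreserving_add_right μ y).quasiMeasurePreserving.ae_eq_comp hf.coeFn_toLp
  filter_upwards [coeFn_translateL2 μ y (hf.toLp f), h1, hg.coeFn_toLp] with x hx hx1 hx2
  simp only [Function.comp_apply] at hx1
  rw [hx, hx1, hx2]
  simp [mul_comm]

theorem inner_toLp {f g : K → ℝ} (hf : MemLp f 2 μ) (hg : MemLp g 2 μ) :
    inner ℝ (hf.toLp f) (hg.toLp g) = ∫ x, f x * g x ∂μ := by
  rw [L2.inner_def]
  refine integral_congr_ae ?_
  filter_upwards [hf.coeFn_toLp, hg.coeFn_toLp] with x hx1 hx2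
  rw [hx1, hx2]
  simp [mul_comm]

theorem continuous_memLp (f : C(K, ℝ)) : MemLp f 2 μ :=
  MemLp.of_bound f.continuous.aestronglyMeasurable ‖f‖ (ae_of_all _ f.norm_coe_le_norm)

theorem continuousToLp_eq (f : C(K, ℝ)) :
    ContinuousMap.toLp 2 μ ℝ f = (continuous_memLp μ f).toLp f := by
  apply Lp.ext
  exact (ContinuousMap.coeFn_toLp μ f).trans (MemLp.coeFn_toLp _).symm

/-- Both sides are the integral of `h (z - x) f z g x`. Without second countability, a Borel
integrand need not be measurable for the product σ-algebra, so the exchange of integrals is made for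
continuous functions and extended by `L²`-density in `inner_corr`. -/
theorem inner_corr_continuous (f g h : C(K, ℝ)) :
    ∫ y, h y * ∫ x, f (x + y) * g x ∂μ ∂μ = ∫ z, f z * ∫ x, g (x + z) * h (-x) ∂μ ∂μ := by
  have hswap : ∀ F : K → K → ℝ, Continuous F.uncurry →
      ∫ y, ∫ x, F y x ∂μ ∂μ = ∫ x, ∫ y, F y x ∂μ ∂μ := fun F hF =>
    integral_integral_swap_of_hasCompactSupport hF (HasCompactSupport.of_compactSpace _)
  calc ∫ y, h y * ∫ x, f (x + y) * g x ∂μ ∂μ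
      = ∫ y, ∫ x, h y * (f (x + y) * g x) ∂μ ∂μ := by simp_rw [integral_const_mul]
    _ = ∫ x, ∫ y, h y * (f (x + y) * g x) ∂μ ∂μ := hswap _ (by
        simp only [Function.uncurry_def]; fun_prop)
    _ = ∫ x, ∫ z, h (z - x) * (f z * g x) ∂μ ∂μ := by
        congr 1 with x
        rw [← integral_sub_right_eq_self (fun y => h y * (f (x + y) * g x)) x]
        simp
    _ = ∫ z, ∫ x, h (z - x) * (f z * g x) ∂μ ∂μ := hswap _ (by
        simp only [Function.uncurry_def]; fun_prop)
    _ = ∫ z, ∫ x, f z * (g (x + z) * h (-x)) ∂μ ∂μ := by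
        congr 1 with z
        rw [← integral_add_right_eq_self (fun x => h (z - x) * (f z * g x)) z]
        congr 1 with x
        rw [show z - (x + z) = -x by abel]
        ring
    _ = _ := by simp_rw [integral_const_mul]

theorem inner_corr (p q r : Lp ℝ 2 μ) :
    inner ℝ r (ContinuousMap.toLp 2 μ ℝ (corr μ p q)) =
      inner ℝ p (ContinuousMap.toLp 2 μ ℝ (corr μ q (reflectL2 μ r))) := by
  have hd : DenseRange (ContinuousMap.toLp 2 μ ℝ : C(K, ℝ) →L[ℝ] Lp ℝ 2 μ) :=
    ContinuousMap.toLp_denseRange ℝ μ ℝ (by norm_num)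
  induction p using hd.induction_on with
  | hp => exact isClosed_eq (by fun_prop) (by fun_prop)
  | ih f =>
  induction q using hd.induction_on with
  | hp => exact isClosed_eq (by fun_prop) (by fun_prop)
  | ih g =>
  induction r using hd.induction_on with
  | hp => exact isClosed_eq (by fun_prop) (by fun_prop)
  | ih h =>
  have hneg : reflectL2 μ (ContinuousMap.toLp 2 μ ℝ h) =
      ((continuous_memLp μ h).comp_measurePreserving (Measure.measurePreserving_neg μ)).toLp _ := by
    rw [continuousToLp_eq]; rfl
  rw [hneg]
  simp only [continuousToLp_eq, inner_toLp, corr_toLp]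
  exact inner_corr_continuous μ f g h

variable {μ}

theorem continuous_integral_add_mul {f g : K → ℝ} (hf : MemLp f 2 μ) (hg : MemLp g 2 μ) :
    Continuous fun y => ∫ x, f (x + y) * g x ∂μ := by
  simp_rw [← corr_toLp μ hf hg]
  exact (corr μ _ _).continuous

/-- Fubini's theorem for correlations of `L²` functions on a compact group which need not be
second countable. -/
theorem integral_mul_integral_add_mul {f g h : K → ℝ} (hf : MemLp f 2 μ) (hg : MemLp g 2 μ)
    (hh : MemLp h 2 μ) :
    ∫ y, h y * ∫ x, f (x + y) * g x ∂μ ∂μ = ∫ z, f z * ∫ x, g (x + z) * h (-x) ∂μ ∂μ := by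
  have := inner_corr μ (hf.toLp f) (hg.toLp g) (hh.toLp h)
  have hneg : reflectL2 μ (hh.toLp h) =
      (hh.comp_measurePreserving (Measure.measurePreserving_neg μ)).toLp _ := rfl
  rw [hneg] at this
  simp only [continuousToLp_eq, inner_toLp, corr_toLp] at this
  exact this

theorem memLp_indicator {E : Set K} (hE : MeasurableSet E) :
    MemLp (E.indicator fun _ => (1 : ℝ)) 2 μ :=
  memLp_indicator_const 2 hE 1 (Or.inr (measure_ne_top μ E))

/-- The measure of the part of `V` which is moved into `E` by `y`. -/
theorem integral_indicator_add_mul_indicator {E V : Set K} (hE : MeasurableSet E)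
    (hV : MeasurableSet V) (y : K) :
    ∫ x, E.indicator (fun _ => (1 : ℝ)) (x + y) * V.indicator (fun _ => (1 : ℝ)) x ∂μ =
      μ.real {x | x + y ∈ E ∧ x ∈ V} := by
  have hm : MeasurableSet {x | x + y ∈ E ∧ x ∈ V} :=
    ((measurable_add_const y) hE).inter hV
  rw [← integral_indicator_one hm]
  congr 1 with x
  by_cases h1 : x + y ∈ E <;> by_cases h2 : x ∈ V <;> simp [h1, h2]

theorem continuous_measure_add_mem {E V : Set K} (hE : MeasurableSet E) (hV : MeasurableSet V) :
    Continuous fun y => μ.real {x | x + y ∈ E ∧ x ∈ V} := by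
  simp_rw [← integral_indicator_add_mul_indicator hE hV]
  exact continuous_integral_add_mul (memLp_indicator hE) (memLp_indicator hV)

/-- For small neighbourhoods `V` of `0`, most points of `E` have most of `y + V` inside `E`. -/
theorem measure_low_density_le {E : Set K} (hE : MeasurableSet E) {ε : ℝ} (hε : 0 < ε) :
    ∃ N ∈ 𝓝 (0 : K), ∀ V ⊆ N, MeasurableSet V → 0 < μ.real V →
      μ.real {y | y ∈ E ∧ μ.real {x | x + y ∈ E ∧ x ∈ V} ≤ 2 / 3 * μ.real V} ≤ ε := by
  -- For `y` near `0` the set `E` overlaps its translate in measure more than `μ E - ε / 3`.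
  -- Averaging over `y ∈ -V` bounds the total overlap below by `μ V (μ E - ε / 3)`, while each point
  -- of the bad set `B` wastes at least `μ V / 3`; comparison gives `μ B ≤ ε`.
  have hself : μ.real {x | x + (0 : K) ∈ E ∧ x ∈ E} = μ.real E := by simp
  have hcont := (continuous_measure_add_mem (μ := μ) hE hE).tendsto 0
  rw [hself] at hcont
  have hN : ∀ᶠ y in 𝓝 (0 : K), μ.real E - ε / 3 < μ.real {x | x + y ∈ E ∧ x ∈ E} :=
    hcont.eventually (lt_mem_nhds (by linarith))
  refine ⟨-{y | μ.real E - ε / 3 < μ.real {x | x + y ∈ E ∧ x ∈ E}},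
    by simpa using neg_mem_nhds_zero K hN, ?_⟩
  intro V hVN hV hV0
  set B := {y | y ∈ E ∧ μ.real {x | x + y ∈ E ∧ x ∈ V} ≤ 2 / 3 * μ.real V} with hB
  have hcD := continuous_measure_add_mem (μ := μ) hE hV
  have hBm : MeasurableSet B := hE.inter (isClosed_le hcD continuous_const).measurableSet
  have hfub := integral_mul_integral_add_mul (μ := μ) (memLp_indicator hE) (memLp_indicator hE)
    (memLp_indicator hV.neg)
  have hVneg : ∀ x, (-V).indicator (fun _ => (1 : ℝ)) (-x) = V.indicator (fun _ => (1 : ℝ)) x :=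
    fun x => by by_cases hx : x ∈ V <;> simp [hx]
  simp only [hVneg, integral_indicator_add_mul_indicator hE hE,
    integral_indicator_add_mul_indicator hE hV] at hfub
  have hVn : μ.real (-V) = μ.real V := by simp [Measure.real]
  have hint : ∀ {f : K → ℝ}, Continuous f → Integrable f μ := fun hf =>
    hf.integrable_of_hasCompactSupport (HasCompactSupport.of_compactSpace _)
  have hind : ∀ (S : Set K) (f : K → ℝ), (fun x => S.indicator (fun _ => (1 : ℝ)) x * f x) =
      S.indicator f := fun S f => by
    ext x; by_cases hx : x ∈ S <;> simp [hx]
  have hlow : μ.real V * (μ.real E - ε / 3) ≤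
      ∫ y, (-V).indicator (fun _ => (1 : ℝ)) y * μ.real {x | x + y ∈ E ∧ x ∈ E} ∂μ := by
    rw [hind, integral_indicator hV.neg, ← hVn]
    have h1 : ∫ _ in -V, (μ.real E - ε / 3) ∂μ = μ.real (-V) * (μ.real E - ε / 3) := by
      rw [setIntegral_const, smul_eq_mul]
    rw [← h1]
    refine setIntegral_mono_on (integrable_const _).integrableOn
      (hint (continuous_measure_add_mem hE hE)).integrableOn hV.neg fun y hy => ?_
    have := hVN hy
    simp only [Set.mem_neg, neg_neg, Set.mem_ofPred_eq] at this
    exact this.le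
  have hup : ∫ z, E.indicator (fun _ => (1 : ℝ)) z * μ.real {x | x + z ∈ E ∧ x ∈ V} ∂μ ≤
      μ.real V * μ.real E - μ.real V / 3 * μ.real B := by
    have h1 : ∫ z, (E.indicator (fun _ => μ.real V) z - B.indicator (fun _ => μ.real V / 3) z) ∂μ =
        μ.real V * μ.real E - μ.real V / 3 * μ.real B := by
      rw [integral_sub ((integrable_const _).indicator hE) ((integrable_const _).indicator hBm),
        integral_indicator hE, integral_indicator hBm, setIntegral_const, setIntegral_const,
        smul_eq_mul, smul_eq_mul, mul_comm, mul_comm (μ.real B)]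
    rw [← h1, hind]
    refine integral_mono ((hint hcD).indicator hE)
      (((integrable_const _).indicator hE).sub ((integrable_const _).indicator hBm)) fun z => ?_
    by_cases hz : z ∈ E
    · have hle : μ.real {x | x + z ∈ E ∧ x ∈ V} ≤ μ.real V :=
        measureReal_mono fun x hx => hx.2
      by_cases hzB : z ∈ B
      · simp only [Set.indicator_of_mem hz, Set.indicator_of_mem hzB]
        have := hzB.2
        linarith
      · simp only [Set.indicator_of_mem hz, Set.indicator_of_notMem hzB]
        linarith
    · have hzB : z ∉ B := fun h => hz h.1
      simp only [Set.indicator_of_notMem hz, Set.indicator_of_notMem hzB, sub_zero, le_refl]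
  rw [hfub] at hlow
  have h2 : μ.real V / 3 * μ.real B ≤ μ.real V / 3 * ε := by linarith
  exact le_of_mul_le_mul_left h2 (by positivity)

/-- Two measurable sets have conull subsets `A₁`, `B₁` such that each `a + b` with `a ∈ A₁`,
`b ∈ B₁` is a sum of elements of the original sets in a positive proportion of ways. -/
theorem exists_conull_subsets {A B : Set K} (hA : MeasurableSet A) (hB : MeasurableSet B) :
    ∃ A₁ ⊆ A, ∃ B₁ ⊆ B, MeasurableSet A₁ ∧ MeasurableSet B₁ ∧ μ (A \ A₁) = 0 ∧ μ (B \ B₁) = 0 ∧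
      ∀ a ∈ A₁, ∀ b ∈ B₁, 0 < μ.real {v | v + a ∈ A ∧ b - v ∈ B} := by
  -- The group need not be metrizable, so a sequence of neighbourhoods is chosen to suit the two
  -- given sets. The bounds `2⁻ⁿ` are summable, and Borel–Cantelli makes almost every point bad only
  -- finitely often. `B` is tested on `-V n` since `v` is added to `a` but subtracted from `b`.
  have hstep : ∀ n : ℕ, ∃ V : Set K, MeasurableSet V ∧ 0 < μ.real V ∧
      μ.real {y | y ∈ A ∧ μ.real {x | x + y ∈ A ∧ x ∈ V} ≤ 2 / 3 * μ.real V} ≤ (1 / 2) ^ n ∧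
      μ.real {y | y ∈ B ∧ μ.real {x | x + y ∈ B ∧ x ∈ -V} ≤ 2 / 3 * μ.real V} ≤ (1 / 2) ^ n := by
    intro n
    obtain ⟨N₁, hN₁, h₁⟩ := measure_low_density_le (μ := μ) hA (ε := (1 / 2) ^ n) (by positivity)
    obtain ⟨N₂, hN₂, h₂⟩ := measure_low_density_le (μ := μ) hB (ε := (1 / 2) ^ n) (by positivity)
    have hN : N₁ ∩ -N₂ ∈ 𝓝 (0 : K) := inter_mem hN₁ (by simpa using neg_mem_nhds_zero K hN₂)
    let V := interior (N₁ ∩ -N₂)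
    have hV : MeasurableSet V := isOpen_interior.measurableSet
    have hV0 : 0 < μ.real V := by
      rw [measureReal_def, ENNReal.toReal_pos_iff]
      exact ⟨isOpen_interior.measure_pos μ ⟨0, mem_interior_iff_mem_nhds.2 hN⟩,
        measure_lt_top μ _⟩
    have hVn : μ.real (-V) = μ.real V := by simp [Measure.real]
    refine ⟨V, hV, hV0, h₁ V (interior_subset.trans Set.inter_subset_left) hV hV0, ?_⟩
    rw [← hVn]
    refine h₂ (-V) (fun x hx => ?_) hV.neg (hVn ▸ hV0)
    have := (interior_subset hx).2
    simpa using this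
  choose V hV hV0 hVA hVB using hstep
  have hVn : ∀ n, μ.real (-V n) = μ.real (V n) := fun n => by simp [Measure.real]
  let SA : ℕ → Set K := fun n =>
    {y | y ∈ A ∧ μ.real {x | x + y ∈ A ∧ x ∈ V n} ≤ 2 / 3 * μ.real (V n)}
  let SB : ℕ → Set K := fun n =>
    {y | y ∈ B ∧ μ.real {x | x + y ∈ B ∧ x ∈ -V n} ≤ 2 / 3 * μ.real (V n)}
  have hSA : ∀ n, MeasurableSet (SA n) := fun n =>
    hA.inter (isClosed_le (continuous_measure_add_mem hA (hV n)) continuous_const).measurableSet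
  have hSB : ∀ n, MeasurableSet (SB n) := fun n =>
    hB.inter (isClosed_le (continuous_measure_add_mem hB (hV n).neg) continuous_const).measurableSet
  have hlim : ∀ S : ℕ → Set K, (∀ n, μ.real (S n) ≤ (1 / 2) ^ n) → μ (limsup S atTop) = 0 := by
    intro S hS
    refine measure_limsup_atTop_eq_zero (ne_of_lt ?_)
    have h1 : ∀ n, μ (S n) ≤ ENNReal.ofReal ((1 / 2) ^ n) := fun n => by
      rw [← ofReal_measureReal]
      exact ENNReal.ofReal_le_ofReal (hS n)
    refine (ENNReal.tsum_le_tsum h1).trans_lt ?_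
    rw [← ENNReal.ofReal_tsum_of_nonneg (fun n => by positivity) summable_geometric_two]
    exact ENNReal.ofReal_lt_top
  refine ⟨A \ limsup SA atTop, Set.sdiff_subset, B \ limsup SB atTop, Set.sdiff_subset,
    hA.diff (MeasurableSet.measurableSet_limsup hSA),
    hB.diff (MeasurableSet.measurableSet_limsup hSB),
    ?_, ?_, ?_⟩
  · rw [Set.sdiff_sdiff_right_self]
    exact measure_mono_null Set.inter_subset_right (hlim SA hVA)
  · rw [Set.sdiff_sdiff_right_self]
    exact measure_mono_null Set.inter_subset_right (hlim SB hVB)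
  intro a ha b hb
  have h1 : ∀ᶠ n in atTop, a ∉ SA n := by
    have := ha.2
    rwa [mem_limsup_iff_frequently_mem, not_frequently] at this
  have h2 : ∀ᶠ n in atTop, b ∉ SB n := by
    have := hb.2
    rwa [mem_limsup_iff_frequently_mem, not_frequently] at this
  obtain ⟨n, hn1, hn2⟩ := (h1.and h2).exists
  have h3 : 2 / 3 * μ.real (V n) < μ.real {x | x + a ∈ A ∧ x ∈ V n} := by
    by_contra h; exact hn1 ⟨ha.1, not_lt.1 h⟩
  have h4 : 2 / 3 * μ.real (V n) < μ.real {x | x + b ∈ B ∧ x ∈ -V n} := by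
    by_contra h; exact hn2 ⟨hb.1, not_lt.1 h⟩
  have h5 : μ.real {x | x + b ∈ B ∧ x ∈ -V n} = μ.real {x | b - x ∈ B ∧ x ∈ V n} := by
    have : {x | b - x ∈ B ∧ x ∈ V n} = -{x | x + b ∈ B ∧ x ∈ -V n} := by
      ext x; simp [sub_eq_add_neg, add_comm]
    rw [this, measureReal_def, measureReal_def, Measure.measure_neg]
  rw [h5] at h4
  -- Two subsets of `V n`, each filling more than two thirds of it, meet in more than one third of
  -- it.
  set P := {x | x + a ∈ A ∧ x ∈ V n}
  set Q := {x | b - x ∈ B ∧ x ∈ V n}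
  have hQm : MeasurableSet Q := (measurable_const_sub b hB).inter (hV n)
  have h6 : μ.real (P ∪ Q) + μ.real (P ∩ Q) = μ.real P + μ.real Q :=
    measureReal_union_add_inter hQm
  have h7 : μ.real (P ∪ Q) ≤ μ.real (V n) :=
    measureReal_mono (Set.union_subset (fun x hx => hx.2) fun x hx => hx.2)
  have h8 : μ.real (P ∩ Q) ≤ μ.real {v | v + a ∈ A ∧ b - v ∈ B} :=
    measureReal_mono fun x hx => ⟨hx.1.1, hx.2.1⟩
  have := hV0 n
  linarith

theorem exists_isSigmaCompact_subset {S : Set K} (hS : MeasurableSet S) :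
    ∃ T ⊆ S, IsSigmaCompact T ∧ μ (S \ T) = 0 := by
  have h : ∀ n : ℕ, ∃ C ⊆ S, IsCompact C ∧ μ (S \ C) < ((n : ℝ≥0∞) + 1)⁻¹ := fun n =>
    hS.exists_isCompact_sdiff_lt (measure_ne_top μ S) (by simp)
  choose C hCS hC hμ using h
  refine ⟨⋃ n, C n, Set.iUnion_subset hCS, isSigmaCompact_iUnion_of_isCompact C hC, ?_⟩
  refine le_antisymm (ENNReal.le_of_forall_pos_le_add fun ε hε _ => ?_) zero_le
  obtain ⟨n, hn⟩ := ENNReal.exists_inv_nat_lt (ENNReal.coe_ne_zero.2 hε.ne')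
  rw [zero_add]
  calc μ (S \ ⋃ n, C n) ≤ μ (S \ C n) :=
        measure_mono (Set.sdiff_subset_sdiff_right (Set.subset_iUnion C n))
    _ ≤ ((n : ℝ≥0∞) + 1)⁻¹ := (hμ n).le
    _ ≤ (n : ℝ≥0∞)⁻¹ := ENNReal.inv_le_inv.2 le_self_add
    _ ≤ ε := hn.le

end CompactGroup

/-! ### Characters of the Bohr compactification and the embedding of its `L²` space -/

section Bohr

open MeasureTheory Filter Topology

/-- By density the hypothesis passes to positive parts of all `L²` functions. Testing against the
negative part of `f` itself shows that the integral of its square is at most zero. -/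
theorem ae_nonneg_of_forall_continuous {K : Type*} [TopologicalSpace K] [CompactSpace K]
    [T2Space K] [MeasurableSpace K] [BorelSpace K] {μ : Measure K} [IsFiniteMeasure μ]
    [μ.WeaklyRegular] {f : K → ℝ} (hf : MemLp f 2 μ)
    (h : ∀ φ : C(K, ℝ), (∀ x, 0 ≤ φ x) → 0 ≤ ∫ x, f x * φ x ∂μ) : 0 ≤ᵐ[μ] f := by
  have h1 : ∀ q : Lp ℝ 2 μ, 0 ≤ inner ℝ (hf.toLp f) (Lp.posPart q) := by
    have hd : DenseRange (ContinuousMap.toLp 2 μ ℝ : C(K, ℝ) →L[ℝ] Lp ℝ 2 μ) :=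
      ContinuousMap.toLp_denseRange ℝ μ ℝ (by norm_num)
    intro q
    induction q using hd.induction_on with
    | hp =>
      exact isClosed_le continuous_const (continuous_const.inner Lp.continuous_posPart)
    | ih φ =>
      have h2 := h ⟨fun x => max (φ x) 0, by fun_prop⟩ fun x => le_max_right _ _
      refine h2.trans (le_of_eq ?_)
      rw [L2.inner_def]
      refine integral_congr_ae ?_
      filter_upwards [hf.coeFn_toLp, Lp.coeFn_posPart (ContinuousMap.toLp 2 μ ℝ φ),
        ContinuousMap.coeFn_toLp (p := 2) (𝕜 := ℝ) μ φ] with x hx1 hx2 hx3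
      rw [hx1, hx2, hx3]
      simp [mul_comm]
  have h2 := h1 (-(hf.toLp f))
  rw [L2.inner_def] at h2
  have h3 : ∀ᵐ x ∂μ, inner ℝ ((hf.toLp f : Lp ℝ 2 μ) x) ((Lp.posPart (-(hf.toLp f)) : Lp ℝ 2 μ) x)
      = - (max (-f x) 0) ^ 2 := by
    filter_upwards [hf.coeFn_toLp, Lp.coeFn_posPart (-(hf.toLp f)), Lp.coeFn_neg (hf.toLp f)]
      with x hx1 hx2 hx3
    rw [hx2, hx3, Pi.neg_apply, hx1]
    rcases le_total 0 (f x) with h0 | h0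
    · simp [h0]
    · rw [max_eq_left (by linarith)]
      simp; ring
  rw [integral_congr_ae h3, integral_neg, neg_nonneg] at h2
  have h4 : Integrable (fun x => (max (-f x) 0) ^ 2) μ := by
    have h5 := L2.integrable_inner (𝕜 := ℝ) (hf.toLp f) (Lp.posPart (-(hf.toLp f)))
    have h6 := ((integrable_congr h3).1 h5).neg
    simpa using h6
  have h5 := (integral_eq_zero_iff_of_nonneg (fun x => by positivity) h4).1
    (le_antisymm h2 (integral_nonneg fun x => by positivity))
  filter_upwards [h5] with x hx
  by_contra hneg
  simp only [Pi.zero_apply, not_le] at hneg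
  have : max (-f x) 0 = -f x := max_eq_left (by linarith)
  simp only [this, Pi.zero_apply] at hx
  nlinarith

variable (Γ : Type*) [AddCommGroup Γ]

instance : (bohrHaar Γ).Regular := by unfold bohrHaar; infer_instance

instance : (bohrHaar Γ).IsAddHaarMeasure := by unfold bohrHaar; infer_instance

instance : IsProbabilityMeasure (bohrHaar Γ) := ⟨by
  exact Measure.addHaarMeasure_self
    (K₀ := (⊤ : TopologicalSpace.PositiveCompacts (BohrCompactification Γ)))⟩

variable {Γ}

/-- The continuous character of `bΓ` given by a character of `Γ`. -/
def bohrChar (χ : AddChar Γ Circle) : C(BohrCompactification Γ, ℂ) where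
  toFun x := ((Additive.toMul x : PontryaginDual (DiscreteDual Γ)) (χ : DiscreteDual Γ) : ℂ)
  continuous_toFun := by
    have h1 : Continuous fun x : PontryaginDual (DiscreteDual Γ) => x (χ : DiscreteDual Γ) :=
      (continuous_eval_const (F := C(DiscreteDual Γ, Circle)) χ).comp
        (ContinuousMonoidHom.isInducing_toContinuousMap (DiscreteDual Γ) Circle).continuous
    exact continuous_subtype_val.comp (h1.comp continuous_toMul)

theorem bohrChar_add (χ : AddChar Γ Circle) (x y : BohrCompactification Γ) :
    bohrChar χ (x + y) = bohrChar χ x * bohrChar χ y := rfl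

theorem bohrChar_bohrEmbedding (χ : AddChar Γ Circle) (γ : Γ) :
    bohrChar χ (bohrEmbedding Γ γ) = χ γ := rfl

theorem bohrChar_mul (χ ψ : AddChar Γ Circle) : bohrChar (χ * ψ) = bohrChar χ * bohrChar ψ := by
  ext x
  have := map_mul (Additive.toMul x : PontryaginDual (DiscreteDual Γ)) (χ : DiscreteDual Γ)
    (ψ : DiscreteDual Γ)
  exact congrArg (Circle.coeHom) this

theorem bohrChar_one : bohrChar (1 : AddChar Γ Circle) = 1 := by
  ext x
  have := map_one (Additive.toMul x : PontryaginDual (DiscreteDual Γ))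
  exact congrArg (Circle.coeHom) this

theorem bohrChar_inv (χ : AddChar Γ Circle) : bohrChar χ⁻¹ = star (bohrChar χ) := by
  ext x
  have := map_inv (Additive.toMul x : PontryaginDual (DiscreteDual Γ)) (χ : DiscreteDual Γ)
  exact (congrArg (Circle.coeHom) this).trans (Circle.coe_inv_eq_conj _)

/-- The star subalgebra of `C(bΓ, ℂ)` generated by the characters. -/
def bohrSubalgebra (Γ : Type*) [AddCommGroup Γ] :
    StarSubalgebra ℂ C(BohrCompactification Γ, ℂ) where
  toSubalgebra := Algebra.adjoin ℂ (Set.range bohrChar)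
  star_mem' := by
    change Algebra.adjoin ℂ (Set.range (bohrChar (Γ := Γ))) ≤
      star (Algebra.adjoin ℂ (Set.range (bohrChar (Γ := Γ))))
    refine Algebra.adjoin_le ?_
    rintro - ⟨χ, rfl⟩
    exact Algebra.subset_adjoin ⟨χ⁻¹, bohrChar_inv χ⟩

theorem bohrSubalgebra_coe : Subalgebra.toSubmodule (bohrSubalgebra Γ).toSubalgebra =
    Submodule.span ℂ (Set.range (bohrChar (Γ := Γ))) := by
  apply Algebra.adjoin_eq_span_of_subset
  refine Set.Subset.trans ?_ Submodule.subset_span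
  intro x hx
  refine Submonoid.closure_induction (fun _ => id) ⟨1, bohrChar_one⟩ ?_ hx
  rintro - - - - ⟨χ, rfl⟩ ⟨ψ, rfl⟩
  exact ⟨χ * ψ, bohrChar_mul χ ψ⟩

theorem bohrSubalgebra_separatesPoints : (bohrSubalgebra Γ).SeparatesPoints := by
  intro x y hxy
  by_contra! h
  refine hxy (Additive.toMul.injective (PontryaginDual.ext fun χ => ?_))
  exact Subtype.coe_injective (h _ ⟨bohrChar χ, Algebra.subset_adjoin ⟨χ, rfl⟩, rfl⟩)

/-- Trigonometric polynomials are dense in `C(bΓ, ℂ)`. -/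
theorem span_bohrChar_closure_eq_top :
    (Submodule.span ℂ (Set.range (bohrChar (Γ := Γ)))).topologicalClosure = ⊤ := by
  rw [← bohrSubalgebra_coe]
  exact congrArg (fun S : StarSubalgebra ℂ C(BohrCompactification Γ, ℂ) =>
    Subalgebra.toSubmodule S.toSubalgebra)
    (ContinuousMap.starSubalgebra_topologicalClosure_eq_top_of_separatesPoints (bohrSubalgebra Γ)
      bohrSubalgebra_separatesPoints)

/-- Restriction of continuous functions on `bΓ` to `Γ`. -/
def restrictBohr : C(BohrCompactification Γ, ℂ) →ₗ[ℂ] EllInfty Γ where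
  toFun φ := ofBounded (fun γ => φ (bohrEmbedding Γ γ)) ‖φ‖ fun _ => φ.norm_coe_le_norm _
  map_add' _ _ := rfl
  map_smul' _ _ := rfl

@[simp] theorem restrictBohr_apply (φ : C(BohrCompactification Γ, ℂ)) (γ : Γ) :
    restrictBohr φ γ = φ (bohrEmbedding Γ γ) := rfl

theorem norm_restrictBohr_le (φ : C(BohrCompactification Γ, ℂ)) : ‖restrictBohr φ‖ ≤ ‖φ‖ :=
  lp.norm_le_of_forall_le (norm_nonneg _) fun _ => φ.norm_coe_le_norm _

theorem restrictBohr_bohrChar (χ : AddChar Γ Circle) : restrictBohr (bohrChar χ) = charFn χ := rfl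

variable {m : EllInfty Γ →ₗ[ℂ] ℂ}

theorem map_charFn_eq_zero (hm : m ∈ invariantMeans Γ) {χ : AddChar Γ Circle} {γ : Γ}
    (hγ : χ γ ≠ 1) : m (charFn χ) = 0 := by
  have h1 : shift γ (charFn χ) = (χ γ : ℂ) • charFn χ := by
    ext x
    rw [shift_apply]
    change ((χ (x + γ) : Circle) : ℂ) = (χ γ : ℂ) * χ x
    rw [AddChar.map_add_eq_mul, Circle.coe_mul, mul_comm]
  have h2 := map_shift hm γ (charFn χ)
  rw [h1, map_smul, smul_eq_mul] at h2
  have h3 : ((χ γ : ℂ) - 1) * m (charFn χ) = 0 := by rw [sub_mul, h2, one_mul, sub_self]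
  refine (mul_eq_zero.1 h3).resolve_left fun h => hγ ?_
  exact Circle.ext (sub_eq_zero.1 h)

theorem integral_bohrChar_eq_zero {χ : AddChar Γ Circle} {γ : Γ} (hγ : χ γ ≠ 1) :
    ∫ x, bohrChar χ x ∂bohrHaar Γ = 0 := by
  have h2 := integral_add_right_eq_self (μ := bohrHaar Γ) (bohrChar χ) (bohrEmbedding Γ γ)
  simp_rw [bohrChar_add, bohrChar_bohrEmbedding] at h2
  rw [integral_mul_const] at h2
  have h3 : (∫ x, bohrChar χ x ∂bohrHaar Γ) * ((χ γ : ℂ) - 1) = 0 := by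
    rw [mul_sub, h2, mul_one, sub_self]
  refine (mul_eq_zero.1 h3).resolve_right fun h => hγ ?_
  exact Circle.ext (sub_eq_zero.1 h)

/-- Every invariant mean restricts to the Haar integral on almost periodic functions. -/
theorem map_restrictBohr (hm : m ∈ invariantMeans Γ) (φ : C(BohrCompactification Γ, ℂ)) :
    m (restrictBohr φ) = ∫ x, φ x ∂bohrHaar Γ := by
  have hint : ∀ φ : C(BohrCompactification Γ, ℂ), Integrable φ (bohrHaar Γ) := fun φ =>
    φ.continuous.integrable_of_hasCompactSupport (HasCompactSupport.of_compactSpace _)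
  -- The difference of the two functionals is continuous. It kills every nontrivial character, since
  -- translation by a `γ` with `χ γ ≠ 1` multiplies both values by `χ γ`, and it kills `1`;
  -- trigonometric polynomials are dense.
  let D : C(BohrCompactification Γ, ℂ) →L[ℂ] ℂ := LinearMap.mkContinuous
    { toFun := fun φ => m (restrictBohr φ) - ∫ x, φ x ∂bohrHaar Γ
      map_add' := fun φ ψ => by
        have := integral_add (hint φ) (hint ψ)
        simp only [ContinuousMap.add_apply, map_add, this]
        ring
      map_smul' := fun c φ => by
        simp only [ContinuousMap.smul_apply, map_smul, integral_smul, RingHom.id_apply, smul_sub] } 2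
    fun φ => by
      refine (norm_sub_le _ _).trans ?_
      have h1 := (hm.1.norm_map_le (restrictBohr φ)).trans (norm_restrictBohr_le φ)
      have h2 := norm_integral_le_of_norm_le_const (μ := bohrHaar Γ)
        (ae_of_all _ fun x => φ.norm_coe_le_norm x)
      simp only [probReal_univ, mul_one] at h2
      linarith
  have hD : (D : C(BohrCompactification Γ, ℂ) →ₗ[ℂ] ℂ).ker = ⊤ := by
    rw [← top_le_iff, ← span_bohrChar_closure_eq_top]
    refine Submodule.topologicalClosure_minimal _ (Submodule.span_le.2 ?_) D.isClosed_ker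
    rintro - ⟨χ, rfl⟩
    change m (restrictBohr (bohrChar χ)) - ∫ x, bohrChar χ x ∂bohrHaar Γ = 0
    by_cases hχ : χ = 1
    · rw [hχ, bohrChar_one, hm.1.map_const 1 fun x => rfl]
      simp
    · obtain ⟨γ, hγ⟩ := DFunLike.ne_iff.1 hχ
      rw [restrictBohr_bohrChar, map_charFn_eq_zero hm hγ, integral_bohrChar_eq_zero hγ, sub_zero]
  have : φ ∈ (D : C(BohrCompactification Γ, ℂ) →ₗ[ℂ] ℂ).ker := hD ▸ Submodule.mem_top
  exact sub_eq_zero.1 this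

theorem inner_restrictBohr (hm : m ∈ invariantMeans Γ) (φ ψ : C(BohrCompactification Γ, ℂ)) :
    inner ℂ (toMeanL2 hm.1 (restrictBohr φ)) (toMeanL2 hm.1 (restrictBohr ψ)) =
      inner ℂ (ContinuousMap.toLp 2 (bohrHaar Γ) ℂ φ) (ContinuousMap.toLp 2 (bohrHaar Γ) ℂ ψ) := by
  rw [inner_toMeanL2, ContinuousMap.inner_toLp]
  have : star (restrictBohr φ) * restrictBohr ψ = restrictBohr (ψ * star φ) := by
    ext x
    change conj (φ (bohrEmbedding Γ x)) * ψ (bohrEmbedding Γ x) =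
      ψ (bohrEmbedding Γ x) * conj (φ (bohrEmbedding Γ x))
    rw [mul_comm]
  rw [this, map_restrictBohr hm]
  rfl

theorem norm_restrictBohr (hm : m ∈ invariantMeans Γ) (φ : C(BohrCompactification Γ, ℂ)) :
    ‖toMeanL2 hm.1 (restrictBohr φ)‖ = ‖ContinuousMap.toLp 2 (bohrHaar Γ) ℂ φ‖ := by
  rw [norm_eq_sqrt_re_inner (𝕜 := ℂ), norm_eq_sqrt_re_inner (𝕜 := ℂ), inner_restrictBohr hm]

theorem denseRange_toLp_bohr :
    DenseRange (ContinuousMap.toLp 2 (bohrHaar Γ) ℂ :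
      C(BohrCompactification Γ, ℂ) →L[ℂ] Lp ℂ 2 (bohrHaar Γ)) :=
  ContinuousMap.toLp_denseRange ℂ (bohrHaar Γ) ℂ (by norm_num)

/-- The isometric embedding `L²(bΓ) → L²(m)` extending restriction of continuous functions. -/
def bohrL2 (hm : m ∈ invariantMeans Γ) : Lp ℂ 2 (bohrHaar Γ) →L[ℂ] MeanL2 hm.1 :=
  (toMeanL2 hm.1 ∘ₗ restrictBohr).extendOfNorm (ContinuousMap.toLp 2 (bohrHaar Γ) ℂ).toLinearMap

theorem bohrL2_toLp (hm : m ∈ invariantMeans Γ) (φ : C(BohrCompactification Γ, ℂ)) :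
    bohrL2 hm (ContinuousMap.toLp 2 (bohrHaar Γ) ℂ φ) = toMeanL2 hm.1 (restrictBohr φ) :=
  LinearMap.extendOfNorm_eq denseRange_toLp_bohr
    ⟨1, fun φ => by rw [one_mul]; exact (norm_restrictBohr hm φ).le⟩ φ

theorem inner_bohrL2 (hm : m ∈ invariantMeans Γ) (p q : Lp ℂ 2 (bohrHaar Γ)) :
    inner ℂ (bohrL2 hm p) (bohrL2 hm q) = inner ℂ p q := by
  induction p, q using denseRange_toLp_bohr.induction_on₂ with
  | hp => exact isClosed_eq (by fun_prop) (by fun_prop)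
  | h φ ψ => rw [bohrL2_toLp, bohrL2_toLp, inner_restrictBohr hm]

theorem koopman_bohrL2 (hm : m ∈ invariantMeans Γ) (b : Γ) (p : Lp ℂ 2 (bohrHaar Γ)) :
    koopman hm b (bohrL2 hm p) =
      bohrL2 hm (translateL2 (bohrHaar Γ) ℂ (bohrEmbedding Γ b) p) := by
  induction p using denseRange_toLp_bohr.induction_on with
  | hp =>
    exact isClosed_eq (by fun_prop)
      ((bohrL2 hm).continuous.comp (translateL2 (bohrHaar Γ) ℂ (bohrEmbedding Γ b)).continuous)
  | ih φ =>
    let ψ : C(BohrCompactification Γ, ℂ) := ⟨fun x => φ (x + bohrEmbedding Γ b), by fun_prop⟩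
    have h1 : translateL2 (bohrHaar Γ) ℂ (bohrEmbedding Γ b) (ContinuousMap.toLp 2 (bohrHaar Γ) ℂ φ)
        = ContinuousMap.toLp 2 (bohrHaar Γ) ℂ ψ := by
      apply Lp.ext
      have h2 := (measurePreserving_add_right (bohrHaar Γ)
        (bohrEmbedding Γ b)).quasiMeasurePreserving.ae_eq_comp
          (ContinuousMap.coeFn_toLp (p := 2) (𝕜 := ℂ) (bohrHaar Γ) φ)
      filter_upwards [coeFn_translateL2 (bohrHaar Γ) (bohrEmbedding Γ b)
        (ContinuousMap.toLp 2 (bohrHaar Γ) ℂ φ), h2,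
        ContinuousMap.coeFn_toLp (p := 2) (𝕜 := ℂ) (bohrHaar Γ) ψ] with x hx1 hx2 hx3
      rw [hx1, hx3]
      exact hx2
    rw [h1, bohrL2_toLp, bohrL2_toLp, koopman_toMeanL2]
    congr 1
    ext x
    rw [shift_apply, restrictBohr_apply, restrictBohr_apply, map_add]
    rfl

end Bohr

/-! ### Densities on the Bohr compactification of subsets of the group -/

section Density

open MeasureTheory Filter Topology

variable {Γ : Type*} [AddCommGroup Γ] {m : EllInfty Γ →ₗ[ℂ] ℂ}

/-- The orthogonal projection of `1_A` to `L²(bΓ)`. -/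
def bohrProjection (hm : m ∈ invariantMeans Γ) (A : Set Γ) : Lp ℂ 2 (bohrHaar Γ) :=
  (bohrL2 hm).adjoint (toMeanL2 hm.1 (indicatorFn A))

theorem inner_bohrProjection (hm : m ∈ invariantMeans Γ) (A : Set Γ) (p : Lp ℂ 2 (bohrHaar Γ)) :
    inner ℂ p (bohrProjection hm A) = inner ℂ (bohrL2 hm p) (toMeanL2 hm.1 (indicatorFn A)) :=
  ContinuousLinearMap.adjoint_inner_right _ _ _

/-- A real continuous function as a complex one. -/
def complexify (φ : C(BohrCompactification Γ, ℝ)) : C(BohrCompactification Γ, ℂ) :=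
  ⟨fun x => (φ x : ℂ), by fun_prop⟩

theorem integral_bohrProjection (hm : m ∈ invariantMeans Γ) (A : Set Γ)
    (φ : C(BohrCompactification Γ, ℝ)) :
    ∫ x, bohrProjection hm A x * (φ x : ℂ) ∂bohrHaar Γ =
      m (restrictBohr (complexify φ) * indicatorFn A) := by
  have h1 := inner_bohrProjection hm A (ContinuousMap.toLp 2 (bohrHaar Γ) ℂ (complexify φ))
  rw [bohrL2_toLp, inner_toMeanL2, L2.inner_def] at h1
  have h2 : star (restrictBohr (complexify φ)) = restrictBohr (complexify φ) := by
    ext x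
    exact Complex.conj_ofReal _
  rw [h2] at h1
  rw [← h1]
  refine integral_congr_ae ?_
  filter_upwards [ContinuousMap.coeFn_toLp (p := 2) (𝕜 := ℂ) (bohrHaar Γ) (complexify φ)] with x hx
  rw [hx]
  change _ = bohrProjection hm A x * conj ((φ x : ℂ))
  rw [Complex.conj_ofReal]

theorem restrictBohr_mul_indicatorFn_apply (φ : C(BohrCompactification Γ, ℝ)) (A : Set Γ) (x : Γ) :
    (restrictBohr (complexify φ) * indicatorFn A) x =
      ((A.indicator (fun x => φ (bohrEmbedding Γ x)) x : ℝ) : ℂ) := by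
  rw [EllInfty.mul_apply, indicatorFn_apply]
  by_cases hx : x ∈ A <;> simp [hx, complexify]

/-- A mean, restricted to a subset of `Γ`, has a density with values in `[0, 1]` on `bΓ`. -/
theorem exists_bohrDensity (hm : m ∈ invariantMeans Γ) (A : Set Γ) :
    ∃ f : BohrCompactification Γ → ℝ, Measurable f ∧ (∀ x, 0 ≤ f x) ∧ (∀ x, f x ≤ 1) ∧
      bohrProjection hm A =ᵐ[bohrHaar Γ] fun x => (f x : ℂ) := by
  set g := bohrProjection hm A with hg
  have hgL : MemLp g 2 (bohrHaar Γ) := Lp.memLp g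
  have hre : MemLp (fun x => (g x).re) 2 (bohrHaar Γ) := hgL.re
  have him : MemLp (fun x => (g x).im) 2 (bohrHaar Γ) := hgL.im
  have hint : ∀ φ : C(BohrCompactification Γ, ℝ),
      Integrable (fun x => g x * (φ x : ℂ)) (bohrHaar Γ) := fun φ =>
    MemLp.integrable_mul (p := 2) (q := 2) hgL
      (MemLp.of_bound (by fun_prop) ‖φ‖ (ae_of_all _ fun x => by
        rw [Complex.norm_real]; exact φ.norm_coe_le_norm x))
  have hreI : ∀ φ : C(BohrCompactification Γ, ℝ), ∫ x, (g x).re * φ x ∂bohrHaar Γ =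
      (m (restrictBohr (complexify φ) * indicatorFn A)).re := fun φ => by
    rw [← integral_bohrProjection hm A φ]
    refine Eq.trans ?_ (integral_re (hint φ))
    simp
  have himI : ∀ φ : C(BohrCompactification Γ, ℝ), ∫ x, (g x).im * φ x ∂bohrHaar Γ = 0 := fun φ => by
    have h1 : (m (restrictBohr (complexify φ) * indicatorFn A)).im = 0 :=
      hm.1.im_eq_zero fun x => by rw [restrictBohr_mul_indicatorFn_apply]; exact Complex.ofReal_im _
    rw [← h1, ← integral_bohrProjection hm A φ]
    refine Eq.trans ?_ (integral_im (hint φ))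
    simp
  have h0 : 0 ≤ᵐ[bohrHaar Γ] fun x => (g x).re := by
    refine ae_nonneg_of_forall_continuous hre fun φ hφ => ?_
    rw [hreI]
    refine (Complex.nonneg_iff.1 (hm.1.nonneg _ fun x => ?_)).1
    rw [restrictBohr_mul_indicatorFn_apply, ← Complex.ofReal_zero, Complex.real_le_real]
    exact Set.indicator_nonneg (fun x _ => hφ _) x
  have h1 : 0 ≤ᵐ[bohrHaar Γ] fun x => 1 - (g x).re := by
    refine ae_nonneg_of_forall_continuous ((memLp_const 1).sub hre) fun φ hφ => ?_
    have hφi : Integrable φ (bohrHaar Γ) :=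
      φ.continuous.integrable_of_hasCompactSupport (HasCompactSupport.of_compactSpace _)
    have h2 : Integrable (fun x => (g x).re * φ x) (bohrHaar Γ) :=
      MemLp.integrable_mul (p := 2) (q := 2) hre (continuous_memLp _ φ)
    simp_rw [sub_mul, one_mul]
    rw [integral_sub hφi h2, hreI, sub_nonneg]
    have h3 := map_restrictBohr hm (complexify φ)
    have h4 : ∫ x, complexify φ x ∂bohrHaar Γ = ((∫ x, φ x ∂bohrHaar Γ : ℝ) : ℂ) :=
      integral_ofReal
    rw [h4] at h3
    have h5 : m (restrictBohr (complexify φ) * indicatorFn A) ≤ m (restrictBohr (complexify φ)) := by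
      refine hm.1.map_mono fun x => ?_
      rw [restrictBohr_mul_indicatorFn_apply]
      refine Complex.real_le_real.2 ?_
      exact Set.indicator_le_self' (fun _ _ => hφ _) x
    rw [h3] at h5
    exact (Complex.le_def.1 h5).1
  have h2 : 0 ≤ᵐ[bohrHaar Γ] fun x => (g x).im :=
    ae_nonneg_of_forall_continuous him fun φ _ => (himI φ).ge
  have h3 : 0 ≤ᵐ[bohrHaar Γ] fun x => -(g x).im :=
    ae_nonneg_of_forall_continuous him.neg fun φ _ => by
      simp only [neg_mul]
      rw [integral_neg, himI, neg_zero]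
  -- The bounds hold only almost everywhere for `g`; truncation makes them hold at every point.
  refine ⟨fun x => max 0 (min 1 (g x).re), ?_, fun x => le_max_left _ _,
    fun x => max_le zero_le_one (min_le_left _ _), ?_⟩
  · exact measurable_const.max (measurable_const.min
      (Complex.measurable_re.comp (Lp.stronglyMeasurable g).measurable))
  · filter_upwards [h0, h1, h2, h3] with x hx0 hx1 hx2 hx3
    simp only [Pi.zero_apply] at hx0 hx1 hx2 hx3
    rw [min_eq_right (by linarith), max_eq_right hx0]
    apply Complex.ext
    · simp
    · simp; linarith

variable {A : Set Γ} {f : BohrCompactification Γ → ℝ}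

theorem integral_density (hm : m ∈ invariantMeans Γ)
    (hf : bohrProjection hm A =ᵐ[bohrHaar Γ] fun x => (f x : ℂ))
    (φ : C(BohrCompactification Γ, ℝ)) :
    m (restrictBohr (complexify φ) * indicatorFn A) = ((∫ x, f x * φ x ∂bohrHaar Γ : ℝ) : ℂ) := by
  rw [← integral_bohrProjection hm A φ]
  refine Eq.trans (integral_congr_ae ?_) (integral_ofReal (𝕜 := ℂ))
  filter_upwards [hf] with x hx
  rw [hx]
  exact (Complex.ofReal_mul _ _).symm

theorem meanOf_nonneg (hm : IsMean m) (A : Set Γ) : 0 ≤ meanOf m A :=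
  (Complex.nonneg_iff.1 (hm.nonneg _ fun x => by
    rw [indicatorFn_apply]; exact Set.indicator_nonneg (fun _ _ => zero_le_one) x)).1

theorem meanOf_compl (hm : IsMean m) (A : Set Γ) : meanOf m Aᶜ = 1 - meanOf m A := by
  have h : indicatorFn Aᶜ = 1 - indicatorFn A := by
    ext x
    rw [EllInfty.sub_apply, indicatorFn_apply, indicatorFn_apply]
    by_cases hx : x ∈ A <;> simp [hx]
  rw [meanOf, meanOf, h, map_sub, hm.map_one']
  simp

theorem integrable_of_mem_Icc {μ : Measure (BohrCompactification Γ)} [IsFiniteMeasure μ]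
    (hfm : Measurable f) (h0 : ∀ x, 0 ≤ f x) (h1 : ∀ x, f x ≤ 1) : Integrable f μ :=
  Integrable.of_bound hfm.aestronglyMeasurable 1 (ae_of_all _ fun x => by
    rw [Real.norm_of_nonneg (h0 x)]; exact h1 x)

/-- The density only controls continuous test functions, so `1_V` is dominated by a Urysohn function
supported in an open set of nearly the same measure. This yields an inequality; for clopen `V` the
indicator is itself continuous and equality holds. -/
theorem meanOf_inter_trace_le_setIntegral (hm : m ∈ invariantMeans Γ) (hfm : Measurable f)
    (h0 : ∀ x, 0 ≤ f x) (h1 : ∀ x, f x ≤ 1)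
    (hf : bohrProjection hm A =ᵐ[bohrHaar Γ] fun x => (f x : ℂ))
    {V : Set (BohrCompactification Γ)} (hV : IsCompact V) :
    meanOf m (A ∩ trace V) ≤ ∫ x in V, f x ∂bohrHaar Γ := by
  have hfi := integrable_of_mem_Icc (μ := bohrHaar Γ) hfm h0 h1
  refine le_of_forall_pos_le_add fun ε hε => ?_
  obtain ⟨O, hVO, hO, hμ⟩ := V.exists_isOpen_lt_add (μ := bohrHaar Γ) (measure_ne_top _ _)
    (ENNReal.ofReal_pos.2 hε).ne'
  have hVm := hV.measurableSet
  have hdiff : (bohrHaar Γ).real (O \ V) ≤ ε := by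
    have h2 := measure_sdiff_lt_of_lt_add hVm.nullMeasurableSet hVO (measure_ne_top _ _) hμ
    exact ENNReal.toReal_le_of_le_ofReal hε.le h2.le
  obtain ⟨φ, hφ0, hφ1, hφ⟩ := exists_continuous_zero_one_of_isClosed hO.isClosed_compl hV.isClosed
    (Set.disjoint_compl_left_iff_subset.2 hVO)
  have h3 : meanOf m (A ∩ trace V) ≤ ∫ x, f x * φ x ∂bohrHaar Γ := by
    rw [← Complex.real_le_real, ← hm.1.map_indicatorFn, ← integral_density hm hf]
    refine hm.1.map_mono fun x => ?_
    rw [restrictBohr_mul_indicatorFn_apply, indicatorFn_apply]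
    by_cases hxA : x ∈ A
    · by_cases hxV : x ∈ trace V
      · have : φ (bohrEmbedding Γ x) = 1 := hφ1 hxV
        simp [hxA, hxV, this]
      · have := (hφ (bohrEmbedding Γ x)).1
        simpa [hxA, hxV] using this
    · simp [hxA]
  have h4 : ∫ x, f x * φ x ∂bohrHaar Γ ≤ ∫ x in O, f x ∂bohrHaar Γ := by
    rw [← integral_indicator hO.measurableSet]
    refine integral_mono (MemLp.integrable_mul (p := 2) (q := 2)
      (MemLp.of_bound hfm.aestronglyMeasurable 1 (ae_of_all _ fun x => by
        rw [Real.norm_of_nonneg (h0 x)]; exact h1 x)) (continuous_memLp _ φ))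
      (hfi.indicator hO.measurableSet) fun x => ?_
    by_cases hx : x ∈ O
    · rw [Set.indicator_of_mem hx]
      exact mul_le_of_le_one_right (h0 x) (hφ x).2
    · have : φ x = 0 := hφ0 hx
      simp [hx, this]
  have h5 : ∫ x in O, f x ∂bohrHaar Γ =
      ∫ x in V, f x ∂bohrHaar Γ + ∫ x in O \ V, f x ∂bohrHaar Γ := by
    rw [← setIntegral_union Set.disjoint_sdiff_right (hO.measurableSet.diff hVm)
      hfi.integrableOn hfi.integrableOn, Set.union_sdiff_cancel hVO]
  have h6 : ∫ x in O \ V, f x ∂bohrHaar Γ ≤ (bohrHaar Γ).real (O \ V) := by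
    have := setIntegral_mono_on hfi.integrableOn (integrable_const (1 : ℝ)).integrableOn
      (hO.measurableSet.diff hVm) fun x _ => h1 x
    simpa using this
  linarith

theorem meanOf_inter_trace_eq_setIntegral (hm : m ∈ invariantMeans Γ)
    (hf : bohrProjection hm A =ᵐ[bohrHaar Γ] fun x => (f x : ℂ))
    {V : Set (BohrCompactification Γ)} (hV : IsClopen V) :
    meanOf m (A ∩ trace V) = ∫ x in V, f x ∂bohrHaar Γ := by
  let φ : C(BohrCompactification Γ, ℝ) :=
    ⟨V.indicator fun _ => 1, continuous_const.indicator (by simp [hV.frontier_eq])⟩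
  have h1 := integral_density hm hf φ
  have h2 : restrictBohr (complexify φ) * indicatorFn A = indicatorFn (A ∩ trace V) := by
    ext x
    rw [restrictBohr_mul_indicatorFn_apply, indicatorFn_apply]
    by_cases hxA : x ∈ A <;> by_cases hxV : bohrEmbedding Γ x ∈ V <;>
      simp [hxA, hxV, φ, trace]
  rw [h2, hm.1.map_indicatorFn] at h1
  rw [Complex.ofReal_injective h1, ← integral_indicator hV.isOpen.measurableSet]
  congr 1 with x
  by_cases hx : x ∈ V <;> simp [φ, hx]

theorem meanOf_eq_integral (hm : m ∈ invariantMeans Γ)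
    (hf : bohrProjection hm A =ᵐ[bohrHaar Γ] fun x => (f x : ℂ)) :
    meanOf m A = ∫ x, f x ∂bohrHaar Γ := by
  have := meanOf_inter_trace_eq_setIntegral hm hf isClopen_univ
  simpa [trace] using this

/-- The properties of a conull subset of the set where the density is positive. -/
theorem conull_subset_density_support (hm : m ∈ invariantMeans Γ) (hfm : Measurable f)
    (h0 : ∀ x, 0 ≤ f x) (h1 : ∀ x, f x ≤ 1)
    (hf : bohrProjection hm A =ᵐ[bohrHaar Γ] fun x => (f x : ℂ))
    {S : Set (BohrCompactification Γ)} (hS : S ⊆ {x | 0 < f x})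
    (hnull : bohrHaar Γ ({x | 0 < f x} \ S) = 0) :
    (∀ V : Set (BohrCompactification Γ), IsCompact V →
      meanOf m (A ∩ trace V) ≤ (bohrHaar Γ).real (S ∩ V)) ∧
    (∀ V : Set (BohrCompactification Γ), IsClopen V →
      ((bohrHaar Γ).real (S ∩ V) = 0 ↔ meanOf m (A ∩ trace V) = 0)) := by
  have hfi := integrable_of_mem_Icc (μ := bohrHaar Γ) hfm h0 h1
  have hcompact : ∀ V : Set (BohrCompactification Γ), IsCompact V →
      meanOf m (A ∩ trace V) ≤ (bohrHaar Γ).real (S ∩ V) := by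
    intro V hV
    refine (meanOf_inter_trace_le_setIntegral hm hfm h0 h1 hf hV).trans ?_
    have hP : MeasurableSet {x | 0 < f x} := measurableSet_lt measurable_const hfm
    -- A density bounded by `1` is at most the indicator of its support.
    have h2 : ∫ x in V, f x ∂bohrHaar Γ ≤ (bohrHaar Γ).real ({x | 0 < f x} ∩ V) := by
      rw [← integral_indicator hV.measurableSet,
        ← integral_indicator_one (hP.inter hV.measurableSet)]
      refine integral_mono (hfi.indicator hV.measurableSet)
        ((integrable_const (1 : ℝ)).indicator (hP.inter hV.measurableSet)) fun x => ?_
      by_cases hx : x ∈ V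
      · rcases (h0 x).eq_or_lt with h | h
        · simp only [Set.indicator_of_mem hx, ← h]
          exact Set.indicator_nonneg (fun _ _ => zero_le_one) x
        · have : x ∈ {x | 0 < f x} ∩ V := ⟨h, hx⟩
          simp only [Set.indicator_of_mem hx, Set.indicator_of_mem this]
          exact h1 x
      · simp only [Set.indicator_of_notMem hx]
        exact Set.indicator_nonneg (fun _ _ => zero_le_one) x
    refine h2.trans ?_
    have h3 : (bohrHaar Γ) ({x | 0 < f x} ∩ V) ≤ bohrHaar Γ (S ∩ V) := by
      calc bohrHaar Γ ({x | 0 < f x} ∩ V)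
          ≤ bohrHaar Γ (S ∩ V ∪ ({x | 0 < f x} \ S)) := by
            refine measure_mono fun x hx => ?_
            by_cases hxS : x ∈ S
            · exact Or.inl ⟨hxS, hx.2⟩
            · exact Or.inr ⟨hx.1, hxS⟩
        _ ≤ bohrHaar Γ (S ∩ V) + bohrHaar Γ ({x | 0 < f x} \ S) := measure_union_le _ _
        _ = bohrHaar Γ (S ∩ V) := by rw [hnull, add_zero]
    exact ENNReal.toReal_mono (measure_ne_top _ _) h3
  refine ⟨hcompact, fun V hV => ⟨fun h => ?_, fun h => ?_⟩⟩
  · exact le_antisymm (h ▸ hcompact V hV.isClosed.isCompact) (meanOf_nonneg hm.1 _)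
  · rw [meanOf_inter_trace_eq_setIntegral hm hf hV] at h
    have h2 := (setIntegral_eq_zero_iff_of_nonneg_ae (ae_of_all _ h0) hfi.integrableOn).1 h
    have h3 : bohrHaar Γ (S ∩ V) = 0 := by
      rw [Filter.EventuallyEq, ae_restrict_iff' hV.isOpen.measurableSet] at h2
      refine measure_mono_null (fun x hx => ?_) (ae_iff.1 h2)
      simp only [Set.mem_ofPred_eq, Classical.not_imp]
      exact ⟨hx.2, (hS hx.1).ne'⟩
    rw [measureReal_def, h3, ENNReal.toReal_zero]

end Density

/-! ### Transfer of correlations to the Bohr compactification -/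

section Sumset

open MeasureTheory Filter Topology

variable {Γ : Type*} [AddCommGroup Γ] {ν m : EllInfty Γ →ₗ[ℂ] ℂ}

theorem memLp_of_mem_Icc {f : BohrCompactification Γ → ℝ} (hfm : Measurable f) (h0 : ∀ x, 0 ≤ f x)
    (h1 : ∀ x, f x ≤ 1) : MemLp f 2 (bohrHaar Γ) :=
  MemLp.of_bound hfm.aestronglyMeasurable 1 (ae_of_all _ fun x => by
    rw [Real.norm_of_nonneg (h0 x)]; exact h1 x)

/-- The averages of the correlations of `1_C` and `1_A` with respect to an extreme invariant mean
`ν` are determined by the densities of `C` and `A` on `bΓ`. -/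
theorem integral_density_mul_correlation (hν : ν ∈ extremeInvariantMeans Γ)
    (hm : m ∈ invariantMeans Γ) {A B C : Set Γ} {f g h : BohrCompactification Γ → ℝ}
    (hf : Measurable f) (hf0 : ∀ x, 0 ≤ f x) (hf1 : ∀ x, f x ≤ 1)
    (hfA : bohrProjection hν.1 A =ᵐ[bohrHaar Γ] fun x => (f x : ℂ))
    (hg : Measurable g) (hg0 : ∀ x, 0 ≤ g x) (hg1 : ∀ x, g x ≤ 1)
    (hgC : bohrProjection hν.1 C =ᵐ[bohrHaar Γ] fun x => (g x : ℂ))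
    (hhB : bohrProjection hm B =ᵐ[bohrHaar Γ] fun x => (h x : ℂ)) :
    m (indicatorFn B * matrixCoeff (koopman hν.1) (inner_koopman_koopman hν.1)
      (toMeanL2 hν.1.1 (indicatorFn C)) (toMeanL2 hν.1.1 (indicatorFn A))) =
      ((∫ y, h y * ∫ x, g (x + y) * f x ∂bohrHaar Γ ∂bohrHaar Γ : ℝ) : ℂ) := by
  set a := toMeanL2 hν.1.1 (indicatorFn A) with ha
  set c := toMeanL2 hν.1.1 (indicatorFn C) with hc
  set p := bohrProjection hν.1 C with hp
  -- `w` is orthogonal to the image of `L²(bΓ)`, in particular to the characters, so its matrix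
  -- coefficients vanish in `L²(m)` and only the projection of `1_C` contributes.
  let w := c - bohrL2 hν.1 p
  have hadj : ∀ q, inner ℂ c (bohrL2 hν.1 q) = inner ℂ p q := fun q =>
    (ContinuousLinearMap.adjoint_inner_left _ _ _).symm
  have hw : ∀ q, inner ℂ w (bohrL2 hν.1 q) = 0 := fun q => by
    rw [inner_sub_left, hadj, inner_bohrL2, sub_self]
  have hzero : matrixCoeffL2 hm (koopman hν.1) (inner_koopman_koopman hν.1) w = 0 := by
    refine matrixCoeffL2_eq_zero hm _ (koopman_add hν.1) _ w fun e he => ?_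
    refine inner_eigenvector_eq_zero hν w (fun χ => ?_) e he
    rw [← restrictBohr_bohrChar, ← bohrL2_toLp]
    exact hw _
  -- The coefficient of the projected part is the restriction to `Γ` of a continuous function on
  -- `bΓ`, so its average over `B` can be computed from the density `h`.
  let k : C(BohrCompactification Γ, ℝ) := ⟨fun y => ∫ x, g (x + y) * f x ∂bohrHaar Γ,
    continuous_integral_add_mul (memLp_of_mem_Icc hg hg0 hg1) (memLp_of_mem_Icc hf hf0 hf1)⟩
  have hk : ∀ b : Γ, inner ℂ (koopman hν.1 b (bohrL2 hν.1 p)) a =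
      (k (bohrEmbedding Γ b) : ℂ) := fun b => by
    rw [koopman_bohrL2, ha, ← inner_bohrProjection, L2.inner_def]
    refine Eq.trans (integral_congr_ae ?_) (integral_ofReal (𝕜 := ℂ))
    have h2 := (measurePreserving_add_right (bohrHaar Γ)
      (bohrEmbedding Γ b)).quasiMeasurePreserving.ae_eq_comp hgC
    filter_upwards [coeFn_translateL2 (bohrHaar Γ) (bohrEmbedding Γ b) p, h2, hfA]
      with x hx1 hx2 hx3
    simp only [Function.comp_apply] at hx2
    rw [hx1, hx2, hx3]
    simp [mul_comm]
  have hsplit : indicatorFn B * matrixCoeff (koopman hν.1) (inner_koopman_koopman hν.1) c a =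
      restrictBohr (complexify k) * indicatorFn B +
        star (indicatorFn B) * matrixCoeff (koopman hν.1) (inner_koopman_koopman hν.1) w a := by
    ext b
    have h3 : star (indicatorFn B) b = indicatorFn B b := by
      rw [lp.star_apply, indicatorFn_apply]
      by_cases hb : b ∈ B <;> simp [hb]
    rw [EllInfty.add_apply, EllInfty.mul_apply, EllInfty.mul_apply, EllInfty.mul_apply, h3,
      matrixCoeff_apply, matrixCoeff_apply]
    have h4 : c = bohrL2 hν.1 p + w := by simp [w]
    have h5 : restrictBohr (complexify k) b = (k (bohrEmbedding Γ b) : ℂ) := rfl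
    rw [h5, ← hk b]
    nth_rewrite 1 [h4]
    rw [map_add, inner_add_left]
    ring
  rw [hsplit, map_add, ← inner_toMeanL2 hm.1, ← matrixCoeffL2_apply hm, hzero,
    zero_apply, inner_zero_right, add_zero, integral_density hm hhB k]
  rfl

end Sumset

end BohrSumset

end

/-! ### The sumset inequality -/

open BohrSumset MeasureTheory

/-- Here `F_σ` means countable union of compact sets, that is, `IsSigmaCompact`. -/
theorem theorem1p4 {Γ : Type*} [AddCommGroup Γ]
    (ν m : BohrSumset.EllInfty Γ →ₗ[ℂ] ℂ)
    (hν : ν ∈ BohrSumset.extremeInvariantMeans Γ) (hm : m ∈ BohrSumset.invariantMeans Γ)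
    (A B : Set Γ) :
    ∃ A' B' : Set (BohrSumset.BohrCompactification Γ),
      IsSigmaCompact A' ∧ IsSigmaCompact B' ∧
      BohrSumset.meanOf ν A ≤ (BohrSumset.bohrHaar Γ).real A' ∧
      BohrSumset.meanOf m B ≤ (BohrSumset.bohrHaar Γ).real B' ∧
      (BohrSumset.bohrHaar Γ).real (A' + B') ≤ BohrSumset.meanOf ν (A + B) ∧
      (∀ V : Set (BohrSumset.BohrCompactification Γ), IsCompact V →
        BohrSumset.meanOf ν (A ∩ BohrSumset.trace V) ≤ (BohrSumset.bohrHaar Γ).real (A' ∩ V) ∧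
        BohrSumset.meanOf m (B ∩ BohrSumset.trace V) ≤ (BohrSumset.bohrHaar Γ).real (B' ∩ V)) ∧
      (∀ V : Set (BohrSumset.BohrCompactification Γ), IsClopen V →
        ((BohrSumset.bohrHaar Γ).real (A' ∩ V) = 0 ↔
          BohrSumset.meanOf ν (A ∩ BohrSumset.trace V) = 0) ∧
        ((BohrSumset.bohrHaar Γ).real (B' ∩ V) = 0 ↔
          BohrSumset.meanOf m (B ∩ BohrSumset.trace V) = 0)) ∧
      (∀ V : Set (BohrSumset.BohrCompactification Γ), IsCompact V → V ⊆ A' + B' →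
        BohrSumset.SubsetMod ν (BohrSumset.trace V) (A + B)) := by
  obtain ⟨f, hf, hf0, hf1, hfA⟩ := exists_bohrDensity hν.1 A
  obtain ⟨h, hh, hh0, hh1, hhB⟩ := exists_bohrDensity hm B
  obtain ⟨g, hg, hg0, hg1, hgC⟩ := exists_bohrDensity hν.1 (A + B)ᶜ
  have hfP : MeasurableSet {x | 0 < f x} := measurableSet_lt measurable_const hf
  have hhP : MeasurableSet {x | 0 < h x} := measurableSet_lt measurable_const hh
  obtain ⟨A₁, hA₁, B₁, hB₁, hA₁m, hB₁m, hA₁n, hB₁n, hpos⟩ :=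
    exists_conull_subsets (μ := bohrHaar Γ) hfP hhP
  obtain ⟨A', hA', hA'c, hA'n⟩ := exists_isSigmaCompact_subset (μ := bohrHaar Γ) hA₁m
  obtain ⟨B', hB', hB'c, hB'n⟩ := exists_isSigmaCompact_subset (μ := bohrHaar Γ) hB₁m
  have hnull : ∀ {S T R : Set (BohrCompactification Γ)}, bohrHaar Γ (S \ T) = 0 →
      bohrHaar Γ (T \ R) = 0 → bohrHaar Γ (S \ R) = 0 := fun {S T R} h1 h2 =>
    measure_mono_null (fun x hx => by
      by_cases hxT : x ∈ T
      · exact Or.inr ⟨hxT, hx.2⟩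
      · exact Or.inl ⟨hx.1, hxT⟩) (measure_union_null h1 h2)
  obtain ⟨hAcomp, hAclopen⟩ := conull_subset_density_support hν.1 hf hf0 hf1 hfA
    (hA'.trans hA₁) (hnull hA₁n hA'n)
  obtain ⟨hBcomp, hBclopen⟩ := conull_subset_density_support hm hh hh0 hh1 hhB
    (hB'.trans hB₁) (hnull hB₁n hB'n)
  have hfL := memLp_of_mem_Icc hf hf0 hf1
  have hgL := memLp_of_mem_Icc hg hg0 hg1
  have hhL := memLp_of_mem_Icc hh hh0 hh1
  have hhL' : MemLp (fun x => h (-x)) 2 (bohrHaar Γ) :=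
    memLp_of_mem_Icc (hh.comp measurable_neg) (fun x => hh0 _) fun x => hh1 _
  -- The convolution of `f` and `h`; the open set `{G > 0}` serves as a measurable set between `A' +
  -- B'` and the zero set of `g`.
  let G : BohrCompactification Γ → ℝ := fun z => ∫ x, f (x + z) * h (-x) ∂bohrHaar Γ
  have hG : Continuous G := continuous_integral_add_mul hfL hhL'
  have hG0 : ∀ z, 0 ≤ G z := fun z => integral_nonneg fun x => mul_nonneg (hf0 _) (hh0 _)
  have hvanish : ∫ z, g z * G z ∂bohrHaar Γ = 0 := by
    have h1 := integral_density_mul_correlation hν hm hf hf0 hf1 hfA hg hg0 hg1 hgC hhB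
    rw [integral_mul_integral_add_mul hgL hfL hhL] at h1
    have h2 : indicatorFn B * matrixCoeff (koopman hν.1) (inner_koopman_koopman hν.1)
        (toMeanL2 hν.1.1 (indicatorFn (A + B)ᶜ)) (toMeanL2 hν.1.1 (indicatorFn A)) = 0 := by
      ext b
      rw [EllInfty.mul_apply, matrixCoeff_apply, koopman_toMeanL2, inner_toMeanL2]
      by_cases hb : b ∈ B
      · have h3 : star (shift b (indicatorFn (A + B)ᶜ)) * indicatorFn A = 0 := by
          ext x
          rw [EllInfty.mul_apply, lp.star_apply, shift_apply, indicatorFn_apply, indicatorFn_apply]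
          by_cases hx : x ∈ A
          · have : x + b ∈ A + B := Set.add_mem_add hx hb
            simp [this]
          · simp [hx]
        rw [h3, map_zero, mul_zero]
        rfl
      · rw [indicatorFn_apply, Set.indicator_of_notMem hb, zero_mul]
        rfl
    rw [h2, map_zero] at h1
    exact (Complex.ofReal_injective h1).symm
  have hgG : ∀ᵐ z ∂bohrHaar Γ, 0 < G z → g z = 0 := by
    have hint : Integrable (fun z => g z * G z) (bohrHaar Γ) :=
      MemLp.integrable_mul (p := 2) (q := 2) hgL (continuous_memLp _ ⟨G, hG⟩)
    have h1 := (integral_eq_zero_iff_of_nonneg (fun z => mul_nonneg (hg0 z) (hG0 z)) hint).1 hvanish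
    filter_upwards [h1] with z hz hGz
    exact (mul_eq_zero.1 hz).resolve_right hGz.ne'
  -- After substitution `G (a + b)` is the integral of `f (v + a) h (b - v)`, whose integrand is
  -- positive on exactly the set that `exists_conull_subsets` guarantees to have positive measure.
  have hsub : A' + B' ⊆ {z | 0 < G z} := by
    rintro _ ⟨a, ha, b, hb, rfl⟩
    have h1 := hpos a (hA' ha) b (hB' hb)
    have h2 : G (a + b) = ∫ v, f (v + a) * h (b - v) ∂bohrHaar Γ := by
      change ∫ v, f (v + (a + b)) * h (-v) ∂bohrHaar Γ = _
      rw [← integral_sub_right_eq_self (fun v => f (v + (a + b)) * h (-v)) b]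
      congr 1 with v
      rw [show v - b + (a + b) = v + a by abel, neg_sub]
    change 0 < G (a + b)
    rw [h2, integral_pos_iff_support_of_nonneg (fun v => mul_nonneg (hf0 _) (hh0 _))]
    · rw [measureReal_def, ENNReal.toReal_pos_iff] at h1
      refine h1.1.trans_le (measure_mono fun v hv => ?_)
      exact (mul_pos hv.1 hv.2).ne'
    · exact MemLp.integrable_mul (p := 2) (q := 2)
        (memLp_of_mem_Icc (hf.comp (measurable_add_const a)) (fun x => hf0 _) fun x => hf1 _)
        (memLp_of_mem_Icc (hh.comp (measurable_const_sub b)) (fun x => hh0 _) fun x => hh1 _)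
  refine ⟨A', B', hA'c, hB'c, ?_, ?_, ?_, fun V hV => ⟨hAcomp V hV, hBcomp V hV⟩,
    fun V hV => ⟨hAclopen V hV, hBclopen V hV⟩, fun V hV hVs => ?_⟩
  · simpa [trace] using hAcomp Set.univ isCompact_univ
  · simpa [trace] using hBcomp Set.univ isCompact_univ
  · have hW : MeasurableSet {z | 0 < G z} := (isOpen_lt continuous_const hG).measurableSet
    refine (measureReal_mono hsub).trans ?_
    have h1 := meanOf_compl hν.1.1 (A + B)
    have h2 := meanOf_eq_integral hν.1 hgC
    -- `g` vanishes almost everywhere on `{G > 0}` and is at most `1` elsewhere, while `∫ g = 1 -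
    -- ν(A + B)`.
    have h3 : ∫ x, g x ∂bohrHaar Γ ≤ (bohrHaar Γ).real {z | 0 < G z}ᶜ := by
      rw [← integral_indicator_one hW.compl]
      refine integral_mono_ae (integrable_of_mem_Icc hg hg0 hg1)
        ((integrable_const (1 : ℝ)).indicator hW.compl) ?_
      filter_upwards [hgG] with z hz
      by_cases hGz : 0 < G z
      · rw [hz hGz]
        exact Set.indicator_nonneg (fun _ _ => zero_le_one) z
      · have : z ∈ {z | 0 < G z}ᶜ := hGz
        rw [Set.indicator_of_mem this]
        exact hg1 z
    rw [probReal_compl_eq_one_sub hW] at h3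
    linarith
  · have h1 := meanOf_inter_trace_le_setIntegral hν.1 hg hg0 hg1 hgC hV
    have h2 : ∫ x in V, g x ∂bohrHaar Γ = 0 := by
      rw [setIntegral_eq_zero_iff_of_nonneg_ae (Filter.Eventually.of_forall hg0)
        (integrable_of_mem_Icc hg hg0 hg1).integrableOn, Filter.EventuallyEq,
        ae_restrict_iff' hV.measurableSet]
      filter_upwards [hgG] with z hz hzV
      exact hz (hsub (hVs hzV))
    have h3 : trace V \ (A + B) = (A + B)ᶜ ∩ trace V := by
      rw [Set.sdiff_eq, Set.inter_comm]
    rw [SubsetMod, h3]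
    exact le_antisymm (h1.trans h2.le) (meanOf_nonneg hν.1.1 _)
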